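/- For a finite simple graph $G$ and a positive integer $t$, the distance between two distinct edges of $G$ is the number of vertices in a shortest path from an endvertex of one to an endvertex of the other (so adjacent edges are at distance $1$; it is infinite if there is no such path), and the distance-$t$ chromatic index $\chi'_t(G)$ is the least number of colours in a colouring of the edges of $G$ in which any two distinct edges at distance at most $t$ receive different colours. The girth of a graph is the length of a shortest cycle, and is infinite if there are no cycles. There is a function $f = f(\Delta,t)$ such that, for every fixed integer $t \ge 1$, $$f(\Delta,t) = (1+o(1))\,\frac{\Delta^t}{t\log\Delta} \qquad (\Delta\to\infty),$$ and such that, for every integer $t\ge 1$, every integer $g \ge 3$ and every integer $\Delta \ge 0$, there is a finite simple graph $G$ of girth at least $g$ and maximum degree at most $\Delta$ with $\chi'_t(G) \ge f(\Delta,t)$. -/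

import Mathlib

open Filter Asymptotics

namespace SimpleGraph

variable {V : Type*}

/-- The distance between two distinct edges `e`, `f` of `G`: the number of vertices in a shortest
path of `G` from an endvertex of `e` to an endvertex of `f` (`⊤` if there is no such path).
Distinct edges that share an endvertex are at distance `1`. -/
noncomputable def edgeDist (G : SimpleGraph V) (e f : Sym2 V) : ℕ∞ :=
  ⨅ (u : V) (v : V) (_ : u ∈ e) (_ : v ∈ f) (p : G.Walk u v) (_ : p.IsPath),
    (p.support.length : ℕ∞)

/-- A distance-`t` edge-colouring: distinct edges within distance `t` get distinct colours. -/
def IsDistEdgeColoring (G : SimpleGraph V) (t : ℕ) {α : Type*} (c : G.edgeSet → α) : Prop :=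
  ∀ e f : G.edgeSet, e ≠ f → G.edgeDist e f ≤ (t : ℕ∞) → c e ≠ c f

/-- A finite graph has a distance-`t` edge-colouring with finitely many colours, so that the
minimum in the definition of the distance-`t` chromatic index is over a nonempty set. -/
theorem exists_isDistEdgeColoring [Finite V] (G : SimpleGraph V) (t : ℕ) :
    {k : ℕ | ∃ c : G.edgeSet → Fin k, G.IsDistEdgeColoring t c}.Nonempty := by
  obtain ⟨k, ⟨c⟩⟩ := Finite.exists_equiv_fin G.edgeSet
  exact ⟨k, c, fun e f hne _ h => hne (c.injective h)⟩

/-- The distance-`t` chromatic index of a finite graph: the least number of colours in a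
distance-`t` edge-colouring. -/
noncomputable def distChromaticIndex [Finite V] (G : SimpleGraph V) (t : ℕ) : ℕ :=
  sInf {k : ℕ | ∃ c : G.edgeSet → Fin k, G.IsDistEdgeColoring t c}

end SimpleGraph

/-! For t = 1 a star suffices. For t ≥ 2 take Δ = d + 1 independent uniform permutations of `Fin N`,
read as perfect matchings between two sides of N vertices, with t, g, Δ fixed and N large. The
expected number of vertices on short closed reduced walks is bounded independently of N, so deleting
all edges at them forces large girth and spoils the surroundings of boundedly many vertices only.

Edges of one colour are at distance more than t. Away from the spoiled vertices, their balls of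
radius a = ⌊(t-1)/2⌋ are therefore disjoint trees, and for even t no edge joins two of these balls
at their leaves. A first moment bound (`card_separated_lt`) shows that typically no m ≈ μN edges are
in this position. A ball has w vertices on each side, with w of order Δ^a, and 2w - 1 edges.
Choosing the m edges contributes an entropy of about log(Δ/μ) per edge. Disjointness of the balls
gains μw² in the exponent per edge; for even t the edges leaving the y leaves on one side must also
miss the mw ball vertices opposite, which gains about μywΔ. Either way the gain is at least about
μΔ^(t-1), while the entropy is about t log Δ. So μ = (1+ε) t log Δ / Δ^(t-1) is enough, and since
there remain nearly ΔN edges in classes of size at most m (`exists_separated`), about Δ^t / ((1+ε) t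
log Δ) colours are needed. -/

/-! ### Permutations with prescribed and forbidden values -/

open Finset in
theorem card_perm_extending_le {α : Type*} [Fintype α] [DecidableEq α] (A : Finset (α × α)) :
    #{π : Equiv.Perm α | ∀ p ∈ A, π p.1 = p.2} ≤ (Fintype.card α - #A).factorial := by
  by_cases h : ∃ π₀ : Equiv.Perm α, ∀ p ∈ A, π₀ p.1 = p.2
  · obtain ⟨π₀, h₀⟩ := h
    set S := A.image Prod.fst with hS
    have hcard : #S = #A := by
      refine card_image_of_injOn fun p hp q hq hpq => ?_
      have := h₀ p hp
      have := h₀ q hq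
      ext
      · exact hpq
      · simp_all
    -- Composing with `π₀⁻¹` turns every extension into a permutation fixing `S` pointwise.
    have key : #{π : Equiv.Perm α | ∀ p ∈ A, π p.1 = p.2} ≤
        Fintype.card {f : Equiv.Perm α // ∀ a, ¬ (a ∉ S) → f a = a} := by
      rw [← Fintype.card_coe]
      refine Fintype.card_le_of_injective
        (fun π => ⟨π₀⁻¹ * π.1, fun a ha => ?_⟩) fun π σ hπσ => ?_
      · rw [not_not, hS, mem_image] at ha
        obtain ⟨p, hp, rfl⟩ := ha
        have h1 := (mem_filter.1 π.2).2 p hp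
        rw [Equiv.Perm.mul_apply, h1, ← h₀ p hp]
        exact π₀.symm_apply_apply _
      · simpa using hπσ
    rw [← Fintype.card_congr (Equiv.Perm.subtypeEquivSubtypePerm fun a => a ∉ S),
      Fintype.card_perm, Fintype.card_subtype_compl, Fintype.card_coe, hcard] at key
    exact key
  · rw [Finset.card_eq_zero.2]
    · exact Nat.zero_le _
    · refine filter_eq_empty_iff.2 fun π _ hπ => h ⟨π, hπ⟩

-- Reveal the permutation on `P` point by point: each new value avoids `S` and is then added to both
-- the prescribed pairs and `S`. Keeping prescribed values inside `S` guarantees that each new pair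
-- is not already in `A`.
open Finset in
theorem card_perm_extending_avoiding_le {α : Type*} [Fintype α] [DecidableEq α]
    (P : Finset α) (A : Finset (α × α)) (S : Finset α) (hA : ∀ p ∈ A, p.2 ∈ S) :
    #{π : Equiv.Perm α | (∀ p ∈ A, π p.1 = p.2) ∧ ∀ a ∈ P, π a ∉ S} ≤
      (Fintype.card α - #S).descFactorial #P * (Fintype.card α - #A - #P).factorial := by
  induction P using Finset.induction_on generalizing A S with
  | empty => simpa using card_perm_extending_le A
  | insert a P ha ih =>
    have hsub : ({π : Equiv.Perm α | (∀ p ∈ A, π p.1 = p.2) ∧ ∀ x ∈ insert a P, π x ∉ S} :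
        Finset _) ⊆ (Sᶜ).biUnion fun b => {π : Equiv.Perm α |
          (∀ p ∈ insert (a, b) A, π p.1 = p.2) ∧ ∀ x ∈ P, π x ∉ insert b S} := by
      intro π hπ
      obtain ⟨h1, h2⟩ := (mem_filter.1 hπ).2
      refine mem_biUnion.2 ⟨π a, by simpa using h2 a (mem_insert_self _ _),
        mem_filter.2 ⟨mem_univ _, ?_, ?_⟩⟩
      · intro p hp
        rcases mem_insert.1 hp with rfl | hp
        · rfl
        · exact h1 p hp
      · intro x hx hmem
        rcases mem_insert.1 hmem with h | h
        · exact ha (π.injective h ▸ hx)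
        · exact h2 x (mem_insert_of_mem hx) h
    refine (card_le_card hsub).trans (card_biUnion_le.trans ?_)
    have hb : ∀ b ∈ Sᶜ, #{π : Equiv.Perm α |
          (∀ p ∈ insert (a, b) A, π p.1 = p.2) ∧ ∀ x ∈ P, π x ∉ insert b S} ≤
        (Fintype.card α - #S - 1).descFactorial #P *
          (Fintype.card α - #A - (#P + 1)).factorial := by
      intro b hb
      rw [mem_compl] at hb
      have h := ih (insert (a, b) A) (insert b S) (fun p hp => by
        rcases mem_insert.1 hp with rfl | hp
        · exact mem_insert_self _ _
        · exact mem_insert_of_mem (hA p hp))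
      rw [card_insert_of_notMem hb, card_insert_of_notMem fun h => hb (hA _ h)] at h
      rw [show Fintype.card α - #A - (#P + 1) = Fintype.card α - (#A + 1) - #P by omega,
        Nat.sub_sub]
      exact h
    refine (sum_le_card_nsmul _ _ _ hb).trans ?_
    rw [card_compl, card_insert_of_notMem ha, smul_eq_mul, ← mul_assoc]
    refine Nat.mul_le_mul_right _ ?_
    rcases Nat.eq_zero_or_pos (Fintype.card α - #S) with h | h
    · simp [h]
    · obtain ⟨n, hn⟩ := Nat.exists_eq_succ_of_ne_zero h.ne'
      rw [hn, Nat.succ_descFactorial_succ, Nat.succ_sub_one]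

theorem descFactorial_mul_pow_le {x y : ℕ} (h : x ≤ y) (l : ℕ) :
    x.descFactorial l * y ^ l ≤ y.descFactorial l * x ^ l := by
  induction l with
  | zero => simp
  | succ l ih =>
    have h1 : (x - l) * y ≤ (y - l) * x := by
      rcases le_or_gt x l with hx | hx
      · simp [Nat.sub_eq_zero_of_le hx]
      · zify [hx.le, (hx.le.trans h)]
        nlinarith
    calc x.descFactorial (l + 1) * y ^ (l + 1)
        = ((x - l) * y) * (x.descFactorial l * y ^ l) := by
          rw [Nat.descFactorial_succ, pow_succ]; ring
      _ ≤ ((y - l) * x) * (y.descFactorial l * x ^ l) := Nat.mul_le_mul h1 ih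
      _ = _ := by rw [Nat.descFactorial_succ, pow_succ]; ring

/-- Each prescribed value has probability at most 1/(N-K), and (N-s)_l / (N-k)_l ≤ (1-(s-k)/N)^l.
The bound `K` is uniform so that the estimates for different colours can be multiplied. -/
theorem descFactorial_mul_factorial_le {N s k l K : ℕ} (hkK : k ≤ K) (hKN : K < N) (hks : k ≤ s) :
    (((N - s).descFactorial l * (N - k - l).factorial : ℕ) : ℝ) ≤
      N.factorial * ((N : ℝ) - K)⁻¹ ^ k * Real.exp (-(l * ((s : ℝ) - k) / N)) := by
  have hKN' : (0 : ℝ) < (N : ℝ) - K := by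
    have : (K : ℝ) < N := by exact_mod_cast hKN
    linarith
  rcases lt_or_ge (N - s) l with hl | hl
  · rw [Nat.descFactorial_eq_zero_iff_lt.2 hl]
    simp only [zero_mul, Nat.cast_zero]
    positivity
  have hkl : k + l ≤ N ∨ l = 0 := by omega
  have hkl : k + l ≤ N := by omega
  have hkN : (0 : ℝ) < (N : ℝ) - k := by
    have : (k : ℝ) ≤ K := by exact_mod_cast hkK
    linarith
  have hN : (0 : ℝ) < N := by
    have : (0 : ℝ) ≤ k := by positivity
    linarith
  have h1 : (((N - s).descFactorial l : ℕ) : ℝ) ≤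
      (N - k).descFactorial l * Real.exp (-(l * ((s : ℝ) - k) / N)) := by
    rcases lt_or_ge N s with hs | hs
    · have hl0 : l = 0 := by omega
      subst hl0
      simp
    have h := descFactorial_mul_pow_le (show N - s ≤ N - k by omega) l
    have h' : (((N - s).descFactorial l : ℕ) : ℝ) * ((N : ℝ) - k) ^ l ≤
        (N - k).descFactorial l * ((N : ℝ) - s) ^ l := by
      have := (Nat.cast_le (α := ℝ)).2 h
      push_cast [Nat.cast_sub hs, Nat.cast_sub (show k ≤ N by omega)] at this
      exact this
    have h2 : ((N : ℝ) - s) ≤ ((N : ℝ) - k) * Real.exp (-(((s : ℝ) - k) / N)) := by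
      have h3 := Real.add_one_le_exp (-(((s : ℝ) - k) / N))
      have h4 : ((N : ℝ) - s) ≤ ((N : ℝ) - k) * (-(((s : ℝ) - k) / N) + 1) := by
        have hks' : (k : ℝ) ≤ s := by exact_mod_cast hks
        have : ((N : ℝ) - k) * (-(((s : ℝ) - k) / N) + 1) - (N - s) = k * (s - k) / N := by
          field_simp; ring
        have : (0 : ℝ) ≤ k * (s - k) / N := by
          apply div_nonneg (mul_nonneg (by positivity) (by linarith)) hN.le
        linarith
      exact h4.trans (mul_le_mul_of_nonneg_left h3 hkN.le)
    have hs' : (0 : ℝ) ≤ (N : ℝ) - s := by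
      have : (s : ℝ) ≤ N := by exact_mod_cast hs
      linarith
    have h5 : ((N : ℝ) - s) ^ l ≤ ((N : ℝ) - k) ^ l * Real.exp (-(l * ((s : ℝ) - k) / N)) := by
      refine (pow_le_pow_left₀ hs' h2 l).trans_eq ?_
      rw [mul_pow, ← Real.exp_nat_mul]
      congr 2
      ring
    have h6 := h'.trans (mul_le_mul_of_nonneg_left h5 (Nat.cast_nonneg _))
    have hp : (0 : ℝ) < ((N : ℝ) - k) ^ l := by positivity
    refine le_of_mul_le_mul_right ?_ hp
    linarith
  have h7 : (((N - k).factorial : ℕ) : ℝ) ≤ N.factorial * ((N : ℝ) - K)⁻¹ ^ k := by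
    rw [inv_pow, ← div_eq_mul_inv, le_div_iff₀ (by positivity)]
    have h8 := Nat.factorial_mul_descFactorial (show k ≤ N by omega)
    have h9 : (N - K) ^ k ≤ N.descFactorial k :=
      (Nat.pow_le_pow_left (by omega) k).trans (Nat.pow_sub_le_descFactorial N k)
    have : (((N - K) ^ k : ℕ) : ℝ) = ((N : ℝ) - K) ^ k := by
      push_cast [Nat.cast_sub hKN.le]; rfl
    rw [← this, ← h8]
    exact_mod_cast Nat.mul_le_mul_left _ h9
  have h10 := Nat.factorial_mul_descFactorial (show l ≤ N - k by omega)
  calc (((N - s).descFactorial l * (N - k - l).factorial : ℕ) : ℝ)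
      ≤ ((N - k).descFactorial l * Real.exp (-(l * ((s : ℝ) - k) / N))) *
        (N - k - l).factorial := by
        push_cast
        exact mul_le_mul_of_nonneg_right h1 (Nat.cast_nonneg _)
    _ = (((N - k).factorial : ℕ) : ℝ) * Real.exp (-(l * ((s : ℝ) - k) / N)) := by
        rw [← h10]; push_cast; ring
    _ ≤ _ := mul_le_mul_of_nonneg_right h7 (Real.exp_nonneg _)

theorem descFactorial_le_pow_mul_exp (N s : ℕ) (hN : 0 < N) :
    (N.descFactorial s : ℝ) ≤ (N : ℝ) ^ s * Real.exp (-((s : ℝ) * (s - 1) / (2 * N))) := by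
  have hN' : (0 : ℝ) < N := by exact_mod_cast hN
  induction s with
  | zero => simp
  | succ s ih =>
    rcases lt_or_ge N s with h | h
    · rw [Nat.descFactorial_eq_zero_iff_lt.2 (by omega)]
      simp only [Nat.cast_zero]
      positivity
    rw [Nat.descFactorial_succ, Nat.cast_mul, Nat.cast_sub h]
    have h1 : (N : ℝ) - s ≤ N * Real.exp (-((s : ℝ) / N)) := by
      have := mul_le_mul_of_nonneg_left (Real.add_one_le_exp (-((s : ℝ) / N))) hN'.le
      refine le_trans (le_of_eq ?_) this
      field_simp
      ring
    have h0 : (0 : ℝ) ≤ (N : ℝ) - s := by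
      have : (s : ℝ) ≤ N := by exact_mod_cast h
      linarith
    refine (mul_le_mul h1 ih (Nat.cast_nonneg _) (by positivity)).trans_eq ?_
    rw [show (N : ℝ) * Real.exp (-((s : ℝ) / N)) * ((N : ℝ) ^ s *
      Real.exp (-((s : ℝ) * (s - 1) / (2 * N)))) = (N : ℝ) ^ (s + 1) *
      (Real.exp (-((s : ℝ) / N)) * Real.exp (-((s : ℝ) * (s - 1) / (2 * N)))) by ring,
      ← Real.exp_add]
    congr 2
    push_cast
    field_simp
    ring

/-! ### Labellings by permutations, walks and closed walks -/

namespace PermGraph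

open Finset

/-- All words of length at most `a`. -/
def words (κ : Type*) [Fintype κ] [DecidableEq κ] : ℕ → Finset (List κ)
  | 0 => {[]}
  | a + 1 => insert [] ((univ ×ˢ words κ a).image fun p => p.1 :: p.2)

theorem mem_words {κ : Type*} [Fintype κ] [DecidableEq κ] {a : ℕ} {l : List κ} :
    l ∈ words κ a ↔ l.length ≤ a := by
  induction a generalizing l with
  | zero => simp [words]
  | succ a ih => cases l <;> simp [words, ih]

theorem card_words_succ (κ : Type*) [Fintype κ] [DecidableEq κ] (a : ℕ) :
    #(words κ (a + 1)) = 1 + Fintype.card κ * #(words κ a) := by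
  rw [words, card_insert_of_notMem (by simp), card_image_of_injective, card_product, card_univ,
    add_comm]
  rintro ⟨a, b⟩ ⟨c, d⟩ h
  simpa using h

variable {C : Type*} {N : ℕ}

/-- Each colour `c` joins `(false, i)` to `(true, π c i)`; this is the resulting involution. -/
def step (π : C → Equiv.Perm (Fin N)) (c : C) (v : Bool × Fin N) : Bool × Fin N :=
  if v.1 then (false, (π c).symm v.2) else (true, π c v.2)

@[simp] theorem step_fst (π : C → Equiv.Perm (Fin N)) (c : C) (v : Bool × Fin N) :
    (step π c v).1 = !v.1 := by
  unfold step; cases h : v.1 <;> simp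

@[simp] theorem step_step (π : C → Equiv.Perm (Fin N)) (c : C) (v : Bool × Fin N) :
    step π c (step π c v) = v := by
  obtain ⟨b, i⟩ := v
  cases b <;> simp [step]

theorem step_injective (π : C → Equiv.Perm (Fin N)) (c : C) : Function.Injective (step π c) :=
  (show Function.Involutive (step π c) from step_step π c).injective

theorem step_ne (π : C → Equiv.Perm (Fin N)) (c : C) (v : Bool × Fin N) : step π c v ≠ v := by
  intro h
  have := congrArg Prod.fst h
  simp at this

/-- The coordinates of the two ends of an edge, the end on the side `false` first. -/
def endPair (u v : Bool × Fin N) : Fin N × Fin N := if u.1 then (v.2, u.2) else (u.2, v.2)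

theorem step_eq_imp {π : C → Equiv.Perm (Fin N)} {c : C} {u v : Bool × Fin N}
    (h : step π c u = v) : π c (endPair u v).1 = (endPair u v).2 := by
  subst h
  obtain ⟨b, i⟩ := u
  cases b <;> simp [endPair, step]

theorem endPair_inj {u v u' v' : Bool × Fin N} (h : u.1 ≠ v.1) (h' : u'.1 ≠ v'.1)
    (hp : endPair u v = endPair u' v') : (u = u' ∧ v = v') ∨ (u = v' ∧ v = u') := by
  obtain ⟨b, i⟩ := u
  obtain ⟨b₁, i₁⟩ := v
  obtain ⟨b₂, i₂⟩ := u'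
  obtain ⟨b₃, i₃⟩ := v'
  cases b <;> cases b₁ <;> cases b₂ <;> cases b₃ <;> simp_all [endPair]

/-- The end of the walk from `v` along the colours of a word, read from its last letter. -/
def run (π : C → Equiv.Perm (Fin N)) (W : List C) (v : Bool × Fin N) : Bool × Fin N :=
  W.foldr (step π) v

@[simp] theorem run_nil (π : C → Equiv.Perm (Fin N)) (v : Bool × Fin N) : run π [] v = v := rfl

@[simp] theorem run_cons (π : C → Equiv.Perm (Fin N)) (c : C) (W : List C) (v : Bool × Fin N) :
    run π (c :: W) v = step π c (run π W v) := rfl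

theorem run_append (π : C → Equiv.Perm (Fin N)) (W W' : List C) (v : Bool × Fin N) :
    run π (W ++ W') v = run π W (run π W' v) := by
  simp [run]

theorem run_reverse_run (π : C → Equiv.Perm (Fin N)) (W : List C) (v : Bool × Fin N) :
    run π W.reverse (run π W v) = v := by
  induction W with
  | nil => rfl
  | cons c W ih => rw [List.reverse_cons, run_append]; simpa using ih

/-- Vertices to which some nonempty reduced word of length at most `L` returns. -/
def shortClosed (π : C → Equiv.Perm (Fin N)) (L : ℕ) : Set (Bool × Fin N) :=
  {v | ∃ W : List C, W ≠ [] ∧ W.IsChain (· ≠ ·) ∧ W.length ≤ L ∧ run π W v = v}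

/-- The walk from `v` along `W` is a closed walk that visits no vertex twice. -/
def SimpleClosed (π : C → Equiv.Perm (Fin N)) (W : List C) (v : Bool × Fin N) : Prop :=
  run π W v = v ∧ ∀ i < W.length, ∀ j < W.length,
    run π (W.drop i) v = run π (W.drop j) v → i = j

/-- Vertices at which a nonempty reduced word of length at most `L` gives a simple closed walk. -/
def shortSimpleClosed (π : C → Equiv.Perm (Fin N)) (L : ℕ) : Set (Bool × Fin N) :=
  {v | ∃ W : List C, W ≠ [] ∧ W.IsChain (· ≠ ·) ∧ W.length ≤ L ∧ SimpleClosed π W v}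

/-- Simple closed walks use distinct edges and can be counted directly; this reduces the others to
them. A repeated vertex cuts out a shorter closed subwalk, whose word is a contiguous part of `W`
and so still reduced; descend until it is simple. -/
theorem exists_run_mem_shortSimpleClosed (π : C → Equiv.Perm (Fin N)) {L : ℕ} {W : List C}
    {v : Bool × Fin N} (h0 : W ≠ []) (hW : W.IsChain (· ≠ ·)) (hL : W.length ≤ L)
    (hv : run π W v = v) :
    ∃ U : List C, U.length ≤ W.length ∧ run π U v ∈ shortSimpleClosed π L := by
  induction hn : W.length using Nat.strong_induction_on generalizing W v with
  | _ n ih =>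
  by_cases hs : SimpleClosed π W v
  · exact ⟨[], by simp, W, h0, hW, hL, hs⟩
  have : ∃ i j, i < j ∧ j < W.length ∧ run π (W.drop i) v = run π (W.drop j) v := by
    simp only [SimpleClosed, hv, true_and, not_forall] at hs
    obtain ⟨i, hi, j, hj, hij, hne⟩ := hs
    rcases lt_or_gt_of_ne hne with h | h
    · exact ⟨i, j, h, hj, hij⟩
    · exact ⟨j, i, h, hi, hij.symm⟩
  obtain ⟨i, j, hij, hj, heq⟩ := this
  set W' := (W.drop i).take (j - i) with hW'
  have hlen : W'.length = j - i := by simp [hW']; omega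
  have hsplit : W.drop i = W' ++ W.drop j := by
    conv_lhs => rw [← List.take_append_drop (j - i) (W.drop i)]
    rw [List.drop_drop, show i + (j - i) = j by omega]
  obtain ⟨U, hU, hmem⟩ := ih (j - i) (by omega) (W := W') (v := run π (W.drop j) v)
    (by intro h; rw [h] at hlen; simp at hlen; omega)
    ((hW.drop i).take _) (by omega)
    (by rw [← run_append, ← hsplit, heq]) hlen
  refine ⟨U ++ W.drop j, ?_, by rwa [run_append]⟩
  simp
  omega

/-! ### Counting labellings -/

section Counting

variable [Fintype C] [DecidableEq C]

/-- The colours are independent, so the bounds for single permutations multiply. The correction `lam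
* #A` bounds the sum over colours of |P_c||A_c|: within a colour, values in `S` already taken by
prescribed pairs exclude nothing further. -/
theorem card_labelling_le (A : Finset (C × (Fin N × Fin N))) (P : Finset (C × Fin N))
    (S : Finset (Fin N)) {K lam : ℕ} (hAS : ∀ p ∈ A, p.2.2 ∈ S) (hKN : K < N) (hKS : K ≤ #S)
    (hK : ∀ c, #{p ∈ A | p.1 = c} ≤ K) (hlam : ∀ c, #{q ∈ P | q.1 = c} ≤ lam) :
    (#{π : C → Equiv.Perm (Fin N) | (∀ p ∈ A, π p.1 p.2.1 = p.2.2) ∧ ∀ q ∈ P, π q.1 q.2 ∉ S} : ℝ) ≤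
      (N.factorial : ℝ) ^ Fintype.card C * ((N : ℝ) - K)⁻¹ ^ #A *
        Real.exp (-((#P * #S - lam * #A) / N)) := by
  set Ac : C → Finset (Fin N × Fin N) := fun c => (A.filter (·.1 = c)).image Prod.snd
  set Pc : C → Finset (Fin N) := fun c => (P.filter (·.1 = c)).image Prod.snd
  have hAc : ∀ c, #(Ac c) = #{p ∈ A | p.1 = c} := fun c =>
    card_image_of_injOn fun p hp q hq h =>
      Prod.ext ((mem_filter.1 hp).2.trans (mem_filter.1 hq).2.symm) h
  have hPc : ∀ c, #(Pc c) = #{p ∈ P | p.1 = c} := fun c =>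
    card_image_of_injOn fun p hp q hq h =>
      Prod.ext ((mem_filter.1 hp).2.trans (mem_filter.1 hq).2.symm) h
  have hsub : ({π : C → Equiv.Perm (Fin N) |
      (∀ p ∈ A, π p.1 p.2.1 = p.2.2) ∧ ∀ q ∈ P, π q.1 q.2 ∉ S} : Finset _) ⊆
      Fintype.piFinset fun c => ({σ : Equiv.Perm (Fin N) |
        (∀ p ∈ Ac c, σ p.1 = p.2) ∧ ∀ a ∈ Pc c, σ a ∉ S} : Finset _) := by
    intro π hπ
    obtain ⟨h1, h2⟩ := (mem_filter.1 hπ).2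
    refine Fintype.mem_piFinset.2 fun c => mem_filter.2 ⟨mem_univ _, ?_, ?_⟩
    · intro p hp
      obtain ⟨q, hq, rfl⟩ := mem_image.1 hp
      obtain ⟨-, rfl⟩ := mem_filter.1 hq
      exact h1 q (mem_filter.1 hq).1
    · intro p hp
      obtain ⟨q, hq, rfl⟩ := mem_image.1 hp
      obtain ⟨-, rfl⟩ := mem_filter.1 hq
      exact h2 q (mem_filter.1 hq).1
  have h1 := card_le_card hsub
  rw [Fintype.card_piFinset] at h1
  have hN : (0 : ℝ) < N := by exact_mod_cast (Nat.zero_le _).trans_lt hKN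
  have hKN' : (0 : ℝ) < (N : ℝ) - K := by
    have : (K : ℝ) < N := by exact_mod_cast hKN
    linarith
  have h2 : ∀ c, ((#{σ : Equiv.Perm (Fin N) |
        (∀ p ∈ Ac c, σ p.1 = p.2) ∧ ∀ a ∈ Pc c, σ a ∉ S} : ℕ) : ℝ) ≤
      N.factorial * ((N : ℝ) - K)⁻¹ ^ #(Ac c) *
        Real.exp (-(#(Pc c) * ((#S : ℝ) - #(Ac c)) / N)) := by
    intro c
    have hk : #(Ac c) ≤ K := (hAc c).trans_le (hK c)
    refine le_trans ?_ (descFactorial_mul_factorial_le hk hKN (hk.trans hKS))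
    have := card_perm_extending_avoiding_le (Pc c) (Ac c) S (fun p hp => by
      obtain ⟨q, hq, rfl⟩ := mem_image.1 hp
      exact hAS q (mem_filter.1 hq).1)
    rw [Fintype.card_fin] at this
    refine Nat.cast_le.2 ?_
    convert this
  have hsumA : ∑ c, #(Ac c) = #A := by
    simp_rw [hAc]
    exact (card_eq_sum_card_fiberwise fun p _ => mem_coe.2 (mem_univ p.1)).symm
  have hsumP : ∑ c, #(Pc c) = #P := by
    simp_rw [hPc]
    exact (card_eq_sum_card_fiberwise fun p _ => mem_coe.2 (mem_univ p.1)).symm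
  calc _ ≤ ((∏ c, #{σ : Equiv.Perm (Fin N) |
        (∀ p ∈ Ac c, σ p.1 = p.2) ∧ ∀ a ∈ Pc c, σ a ∉ S} : ℕ) : ℝ) := by exact_mod_cast h1
    _ ≤ ∏ c, (N.factorial * ((N : ℝ) - K)⁻¹ ^ #(Ac c) *
        Real.exp (-(#(Pc c) * ((#S : ℝ) - #(Ac c)) / N))) := by
        push_cast
        exact prod_le_prod (fun _ _ => Nat.cast_nonneg _) fun c _ => h2 c
    _ = (N.factorial : ℝ) ^ Fintype.card C * ((N : ℝ) - K)⁻¹ ^ #A *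
        Real.exp (∑ c, -(#(Pc c) * ((#S : ℝ) - #(Ac c)) / N)) := by
        rw [prod_mul_distrib, prod_mul_distrib, prod_const, card_univ, prod_pow_eq_pow_sum,
          hsumA, Real.exp_sum]
    _ ≤ _ := by
        refine mul_le_mul_of_nonneg_left (Real.exp_le_exp.2 ?_) (by positivity)
        rw [sum_neg_distrib, ← sum_div]
        refine neg_le_neg (div_le_div_of_nonneg_right ?_ hN.le)
        have e1 : (∑ c, (#(Pc c) : ℝ) * ((#S : ℝ) - #(Ac c))) =
            #P * #S - ∑ c, (#(Pc c) : ℝ) * #(Ac c) := by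
          simp_rw [mul_sub]
          rw [sum_sub_distrib, ← sum_mul]
          congr 2
          exact_mod_cast hsumP
        have e2 : (∑ c, (#(Pc c) : ℝ) * #(Ac c)) ≤ lam * #A := by
          rw [← hsumA]
          push_cast
          rw [mul_sum]
          refine sum_le_sum fun c _ => mul_le_mul_of_nonneg_right ?_ (Nat.cast_nonneg _)
          exact_mod_cast (hPc c).trans_le (hlam c)
        linarith

open Classical in
theorem card_run_preimage_le (π : C → Equiv.Perm (Fin N)) (S : Finset (Bool × Fin N)) (L : ℕ) :
    #{v | ∃ W : List C, W.length ≤ L ∧ run π W v ∈ S} ≤ #(words C L) * #S := by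
  have : ({v | ∃ W : List C, W.length ≤ L ∧ run π W v ∈ S} : Finset (Bool × Fin N)) ⊆
      (words C L ×ˢ S).image fun p => run π p.1.reverse p.2 := by
    intro v hv
    obtain ⟨W, hW, hm⟩ := (mem_filter.1 hv).2
    exact mem_image.2 ⟨(W, run π W v), mem_product.2 ⟨mem_words.2 hW, hm⟩, run_reverse_run π W v⟩
  exact (card_le_card this).trans (card_image_le.trans_eq (card_product _ _))

-- There are (2N)^ℓ choices for the visited vertices, and the ℓ distinct edges have probability at
-- most (N-ℓ)^(-ℓ); for 2ℓ ≤ N the quotient 2N/(N-ℓ) is at most 4. The proportion is thus bounded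
-- independently of N.
open Classical in
theorem card_simpleClosed_le (W : List C) (h0 : W ≠ []) (hW : W.IsChain (· ≠ ·))
    (hN : 2 * W.length ≤ N) :
    (#{p : (C → Equiv.Perm (Fin N)) × (Bool × Fin N) | SimpleClosed p.1 W p.2} : ℝ) ≤
      4 ^ W.length * (N.factorial : ℝ) ^ Fintype.card C := by
  set ℓ := W.length with hℓ
  have hpos : 0 < ℓ := List.length_pos_iff.2 h0
  set R : (Fin ℓ → Bool × Fin N) → Finset (C → Equiv.Perm (Fin N)) := fun ψ =>
    {π | ∃ v, SimpleClosed π W v ∧ ∀ i : Fin ℓ, ψ i = run π (W.drop i) v} with hR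
  have hsub : #{p : (C → Equiv.Perm (Fin N)) × (Bool × Fin N) | SimpleClosed p.1 W p.2} ≤
      #(univ.sigma R) := by
    refine card_le_card_of_injOn
      (fun p => ⟨fun i : Fin ℓ => run p.1 (W.drop i) p.2, p.1⟩) ?_ ?_
    · intro p hp
      have hp := (mem_filter.1 hp).2
      exact mem_sigma.2 ⟨mem_univ _, mem_filter.2 ⟨mem_univ _, p.2, hp, fun i => rfl⟩⟩
    · intro p hp q hq h
      have hp := (mem_filter.1 hp).2
      have hq := (mem_filter.1 hq).2
      simp only [Sigma.mk.injEq, heq_eq_eq] at h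
      refine Prod.ext h.2 ?_
      have := congrFun h.1 ⟨0, hpos⟩
      simp only [List.drop_zero] at this
      rwa [hp.1, hq.1] at this
  have hbound : ∀ ψ, (#(R ψ) : ℝ) ≤ (N.factorial : ℝ) ^ Fintype.card C * ((N : ℝ) - ℓ)⁻¹ ^ ℓ := by
    intro ψ
    have hNℓ : (0 : ℝ) < (N : ℝ) - ℓ := by
      have : ((ℓ + 1 : ℕ) : ℝ) ≤ N := by exact_mod_cast (show ℓ + 1 ≤ N by omega)
      push_cast at this
      linarith
    rcases (R ψ).eq_empty_or_nonempty with he | ⟨π₀, hπ₀⟩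
    · rw [he]; simp only [card_empty, Nat.cast_zero]; positivity
    set nxt : Fin ℓ → Bool × Fin N := fun i =>
      if h : i.1 + 1 < ℓ then ψ ⟨i.1 + 1, h⟩ else ψ ⟨0, hpos⟩ with hnxt
    have hreal : ∀ π ∈ R ψ, ∀ i : Fin ℓ, step π (W.get i) (nxt i) = ψ i := by
      intro π hπ i
      obtain ⟨v, hv, hψ⟩ := (mem_filter.1 hπ).2
      have e1 : nxt i = run π (W.drop (i + 1)) v := by
        simp only [hnxt]
        split_ifs with h
        · exact hψ _
        · have hi := i.2
          rw [hψ, List.drop_eq_nil_of_le (show W.length ≤ i + 1 by omega)]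
          simpa using hv.1
      rw [e1, hψ, ← run_cons]
      congr 1
      simp
    have hinj : Function.Injective ψ := by
      obtain ⟨v, hv, hψ⟩ := (mem_filter.1 hπ₀).2
      intro i j hij
      rw [hψ, hψ] at hij
      exact Fin.ext (hv.2 _ i.2 _ j.2 hij)
    set e : Fin ℓ → C × (Fin N × Fin N) := fun i => (W.get i, endPair (nxt i) (ψ i)) with he
    have hside : ∀ i, (nxt i).1 ≠ (ψ i).1 := by
      intro i
      rw [← hreal π₀ hπ₀ i]
      simp
    have hlt : ∀ i j : Fin ℓ, i < j → e i ≠ e j := by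
      intro i j hij h
      simp only [he, Prod.mk.injEq] at h
      rcases endPair_inj (hside i) (hside j) h.2 with h' | h'
      · exact hij.ne (hinj h'.2)
      -- An edge used in both directions would be used in consecutive steps, as the vertices are
      -- distinct; but consecutive colours differ.
      · have h3 : nxt i = ψ ⟨i.1 + 1, by omega⟩ := by
          simp only [hnxt]; rw [dif_pos]
        have h4 : i.1 + 1 = j.1 := by
          have := hinj (h3.symm.trans h'.1)
          rw [← this]
        have h5 := List.isChain_iff_getElem.1 hW i (by omega)
        apply h5
        have := h.1
        simp only [List.get_eq_getElem] at this
        simp only [h4]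
        exact this
    have hei : Function.Injective e := by
      intro i j h
      by_contra hne
      rcases lt_or_gt_of_ne hne with h' | h'
      · exact hlt i j h' h
      · exact hlt j i h' h.symm
    have hcard : #(univ.image e) = ℓ := by
      rw [card_image_of_injective _ hei, card_univ, Fintype.card_fin]
    have := card_labelling_le (univ.image e) ∅ univ (K := ℓ) (lam := 0) (by simp) (by omega)
      (by rw [card_univ, Fintype.card_fin]; omega)
      (fun c => (card_filter_le _ _).trans_eq hcard) (by simp)
    rw [hcard] at this
    simp only [card_empty, Nat.cast_zero, zero_mul, sub_self, zero_div, neg_zero, Real.exp_zero,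
      mul_one] at this
    refine le_trans ?_ this
    norm_cast
    refine card_le_card fun π hπ => mem_filter.2 ⟨mem_univ _, ?_, by simp⟩
    intro p hp
    obtain ⟨i, -, rfl⟩ := mem_image.1 hp
    exact step_eq_imp (hreal π hπ i)
  have hN0 : (0 : ℝ) < N := by exact_mod_cast (show 0 < N by omega)
  have h2ℓ : (2 * ℓ : ℝ) ≤ N := by exact_mod_cast hN
  calc _ ≤ ((#(univ.sigma R) : ℕ) : ℝ) := by exact_mod_cast hsub
    _ = ∑ ψ, (#(R ψ) : ℝ) := by rw [card_sigma]; push_cast; rfl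
    _ ≤ ∑ ψ : Fin ℓ → Bool × Fin N,
        (N.factorial : ℝ) ^ Fintype.card C * ((N : ℝ) - ℓ)⁻¹ ^ ℓ := sum_le_sum fun ψ _ => hbound ψ
    _ = ((2 * N) * ((N : ℝ) - ℓ)⁻¹) ^ ℓ * (N.factorial : ℝ) ^ Fintype.card C := by
        rw [sum_const, card_univ, Fintype.card_fun, Fintype.card_prod, Fintype.card_bool,
          Fintype.card_fin, Fintype.card_fin, nsmul_eq_mul, mul_pow]
        push_cast
        ring
    _ ≤ _ := by
        refine mul_le_mul_of_nonneg_right (pow_le_pow_left₀ ?_ ?_ _) (by positivity)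
        · exact mul_nonneg (by positivity) (inv_nonneg.2 (by linarith))
        · rw [← div_eq_mul_inv, div_le_iff₀ (by linarith)]
          linarith

open Classical in
/-- On average a labelling has boundedly many vertices on short simple closed walks. -/
theorem sum_card_shortSimpleClosed_le {L : ℕ} (hN : 2 * L ≤ N) :
    (∑ π : C → Equiv.Perm (Fin N), (#{v | v ∈ shortSimpleClosed π L} : ℝ)) ≤
      #(words C L) * 4 ^ L * (N.factorial : ℝ) ^ Fintype.card C := by
  set Ws := (words C L).filter fun W => W ≠ [] ∧ W.IsChain (· ≠ ·)
  have h1 : ∑ π : C → Equiv.Perm (Fin N), #{v | v ∈ shortSimpleClosed π L} ≤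
      ∑ W ∈ Ws, #{p : (C → Equiv.Perm (Fin N)) × (Bool × Fin N) | SimpleClosed p.1 W p.2} := by
    rw [← card_sigma, ← card_sigma]
    have : (univ.sigma fun π : C → Equiv.Perm (Fin N) =>
        ({v | v ∈ shortSimpleClosed π L} : Finset (Bool × Fin N))) ⊆
        (Ws.sigma fun W => ({p : (C → Equiv.Perm (Fin N)) × (Bool × Fin N) |
          SimpleClosed p.1 W p.2} : Finset _)).image fun q =>
          (⟨q.2.1, q.2.2⟩ : Σ _ : C → Equiv.Perm (Fin N), Bool × Fin N) := by
      rintro ⟨π, v⟩ h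
      obtain ⟨W, h0, hW, hL, hs⟩ := (mem_filter.1 (mem_sigma.1 h).2).2
      refine mem_image.2 ⟨⟨W, (π, v)⟩, mem_sigma.2 ⟨?_, ?_⟩, rfl⟩
      · exact mem_filter.2 ⟨mem_words.2 hL, h0, hW⟩
      · exact mem_filter.2 ⟨mem_univ _, hs⟩
    exact (card_le_card this).trans card_image_le
  calc _ ≤ ∑ W ∈ Ws, (#{p : (C → Equiv.Perm (Fin N)) × (Bool × Fin N) |
        SimpleClosed p.1 W p.2} : ℝ) := by exact_mod_cast h1
    _ ≤ ∑ W ∈ Ws, 4 ^ L * (N.factorial : ℝ) ^ Fintype.card C := by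
        refine sum_le_sum fun W hW => ?_
        obtain ⟨hm, h0, hc⟩ := mem_filter.1 hW
        have hl := mem_words.1 hm
        refine (card_simpleClosed_le W h0 hc (by omega)).trans ?_
        exact mul_le_mul_of_nonneg_right (pow_le_pow_right₀ (by norm_num) hl) (by positivity)
    _ ≤ _ := by
        rw [sum_const, nsmul_eq_mul, ← mul_assoc]
        refine mul_le_mul_of_nonneg_right (mul_le_mul_of_nonneg_right ?_ (by positivity))
          (by positivity)
        exact_mod_cast card_filter_le _ _

open Classical in
theorem card_shortClosed_le (π : C → Equiv.Perm (Fin N)) (L : ℕ) :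
    #{v | v ∈ shortClosed π L} ≤ #(words C L) * #{v | v ∈ shortSimpleClosed π L} := by
  refine (card_le_card ?_).trans
    (card_run_preimage_le π ({v | v ∈ shortSimpleClosed π L} : Finset _) L)
  intro v hv
  obtain ⟨W, h0, hW, hL, hv⟩ := (mem_filter.1 hv).2
  obtain ⟨U, hU, hm⟩ := exists_run_mem_shortSimpleClosed π h0 hW hL hv
  exact mem_filter.2 ⟨mem_univ _, U, hU.trans hL, mem_filter.2 ⟨mem_univ _, hm⟩⟩

end Counting

end PermGraph

/-! ### The pruned graph: girth, degree and good vertices -/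

namespace SimpleGraph

theorem edgeDist_le_length_add_one {V : Type*} {G : SimpleGraph V} {e f : Sym2 V} {u v : V}
    (hu : u ∈ e) (hv : v ∈ f) (p : G.Walk u v) : G.edgeDist e f ≤ ((p.length + 1 : ℕ) : ℕ∞) := by
  classical
  refine (iInf_le_of_le u <| iInf_le_of_le v <| iInf_le_of_le hu <| iInf_le_of_le hv <|
    iInf_le_of_le p.bypass <| iInf_le_of_le p.bypass_isPath le_rfl).trans ?_
  rw [Walk.length_support]
  exact_mod_cast Nat.succ_le_succ p.length_bypass_le_length

theorem exists_isDistEdgeColoring_distChromaticIndex {V : Type*} [Finite V] (G : SimpleGraph V)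
    (t : ℕ) : ∃ c : G.edgeSet → Fin (G.distChromaticIndex t), G.IsDistEdgeColoring t c :=
  Nat.sInf_mem (G.exists_isDistEdgeColoring t)

end SimpleGraph

namespace PermGraph

open Finset

section Graph

variable {C : Type*} {N : ℕ}

/-- Cancel equal leading letters; if the leading letters differ, `W.reverse ++ W'` is reduced and
returns to `r`. So walks from `r` see a tree. -/
theorem eq_of_run_eq (π : C → Equiv.Perm (Fin N)) {L : ℕ} {r : Bool × Fin N}
    (hr : r ∉ shortClosed π L) {W W' : List C} (hW : W.IsChain (· ≠ ·)) (hW' : W'.IsChain (· ≠ ·))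
    (hL : W.length + W'.length ≤ L) (h : run π W r = run π W' r) : W = W' := by
  induction W generalizing W' with
  | nil =>
    by_contra hne
    exact hr ⟨W', Ne.symm hne, hW', by simpa using hL, h.symm⟩
  | cons c W ih =>
    rcases W' with _ | ⟨c', W'⟩
    · exact (hr ⟨c :: W, by simp, hW, by simpa using hL, h⟩).elim
    by_cases hc : c = c'
    · subst hc
      rw [ih (W' := W') hW.tail hW'.tail (by simp at hL; omega) (step_injective π c h)]
    · refine (hr ⟨(c :: W).reverse ++ c' :: W', by simp, ?_,
        by simp at hL ⊢; omega, ?_⟩).elim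
      · refine List.IsChain.append ?_ hW' ?_
        · rw [List.isChain_reverse]
          exact hW.imp fun _ _ h => h.symm
        · simpa using hc
      · rw [run_append, ← h, run_reverse_run]

/-- The graph of a labelling, without the edges at vertices on short closed walks. -/
def graph (π : C → Equiv.Perm (Fin N)) (L : ℕ) : SimpleGraph (Bool × Fin N) where
  Adj u v := (∃ c, step π c u = v) ∧ u ∉ shortClosed π L ∧ v ∉ shortClosed π L
  symm := ⟨by
    rintro u v ⟨⟨c, rfl⟩, h1, h2⟩
    exact ⟨⟨c, step_step π c u⟩, h2, h1⟩⟩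
  loopless := ⟨fun u ⟨⟨c, h⟩, _⟩ => step_ne π c u h⟩

/-- Repeating a colour would traverse the same edge back, which a trail forbids. The last conjunct,
placing the edge of the leading letter on the trail, carries the induction. -/
theorem exists_word_of_isTrail (π : C → Equiv.Perm (Fin N)) (L : ℕ) {u v : Bool × Fin N}
    (p : (graph π L).Walk u v) (hp : p.IsTrail) :
    ∃ W : List C, W.IsChain (· ≠ ·) ∧ W.length = p.length ∧ run π W v = u ∧
      ∀ c ∈ W.head?, s(u, step π c u) ∈ p.edges := by
  induction p with
  | nil => exact ⟨[], by simp⟩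
  | @cons u x v h p ih =>
    rw [SimpleGraph.Walk.isTrail_cons] at hp
    obtain ⟨W, hW, hlen, hrun, hhead⟩ := ih hp.1
    obtain ⟨c, rfl⟩ := h.1
    refine ⟨c :: W, ?_, by rw [SimpleGraph.Walk.length_cons, List.length_cons, hlen],
      by simp [hrun], fun c' hc' => ?_⟩
    swap
    · obtain rfl : c = c' := by simpa using hc'
      rw [SimpleGraph.Walk.edges_cons]
      exact List.mem_cons_self
    rw [List.isChain_cons]
    refine ⟨fun c' hc' hcc' => hp.2 ?_, hW⟩
    subst hcc'
    have := hhead c hc'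
    rwa [step_step, Sym2.eq_swap] at this

/-- A short cycle would put its base vertex in `shortClosed`, but no edge at such a vertex survives.
-/
theorem lt_length_of_isCycle (π : C → Equiv.Perm (Fin N)) (L : ℕ) {u : Bool × Fin N}
    (p : (graph π L).Walk u u) (hp : p.IsCycle) : L < p.length := by
  by_contra hL
  obtain ⟨W, hW, hlen, hrun, -⟩ := exists_word_of_isTrail π L p hp.isTrail
  have hadj := p.adj_snd hp.not_nil
  refine hadj.2.1 ⟨W, ?_, hW, by omega, hrun⟩
  have := hp.three_le_length
  rintro rfl
  simp at hlen
  omega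

open Classical in
theorem degree_graph_le [Fintype C] (π : C → Equiv.Perm (Fin N)) (L : ℕ) (u : Bool × Fin N)
    [Fintype ((graph π L).neighborSet u)] : (graph π L).degree u ≤ Fintype.card C := by
  have : (graph π L).neighborFinset u ⊆ univ.image fun c => step π c u := by
    intro v hv
    obtain ⟨⟨c, hc⟩, -⟩ := (SimpleGraph.mem_neighborFinset _ _ _).1 hv
    exact mem_image.2 ⟨c, mem_univ _, hc⟩
  exact (card_le_card this).trans card_image_le

/-- No short closed walk comes within distance `a + 1` of `(false, i)`. -/
def Good (π : C → Equiv.Perm (Fin N)) (L a : ℕ) (i : Fin N) : Prop :=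
  ∀ W : List C, W.length ≤ a + 1 → run π W (false, i) ∉ shortClosed π L

open Classical in
theorem card_good_add_le [Fintype C] [DecidableEq C] (π : C → Equiv.Perm (Fin N)) (L a : ℕ) :
    N ≤ #{i | Good π L a i} + #(words C (a + 1)) * #{v | v ∈ shortClosed π L} := by
  have h1 : #{i | ¬ Good π L a i} ≤ #(words C (a + 1)) * #{v | v ∈ shortClosed π L} := by
    refine le_trans ?_ (card_run_preimage_le π ({v | v ∈ shortClosed π L} : Finset _) (a + 1))
    refine card_le_card_of_injOn (fun i => (false, i)) ?_ fun i _ j _ h => (Prod.mk.inj h).2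
    intro i hi
    have hi := (mem_filter.1 hi).2
    simp only [Good, not_forall, not_not] at hi
    obtain ⟨W, hW, hm⟩ := hi
    exact mem_filter.2 ⟨mem_univ _, W, hW, mem_filter.2 ⟨mem_univ _, hm⟩⟩
  have h2 : #{i | Good π L a i} + #{i | ¬ Good π L a i} = #(univ : Finset (Fin N)) :=
    card_filter_add_card_filter_not _
  rw [card_univ, Fintype.card_fin] at h2
  omega

end Graph

/-! ### Balls around edges and separated sets of edges -/

variable {d N : ℕ}

/-- Words over `Fin d` encode reduced words over `Fin (d + 1)` that continue a word with last
colour `γ`; this is the last colour of the encoded word. The last letter comes first. -/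
def col (γ : Fin (d + 1)) : List (Fin d) → Fin (d + 1)
  | [] => γ
  | j :: l => (col γ l).succAbove j

/-- The vertex on side `τ` reached from the edge `e` along the word `l`. -/
def node (π : Fin (d + 1) → Equiv.Perm (Fin N)) (e : Fin N × Fin (d + 1)) :
    Bool → List (Fin d) → Bool × Fin N
  | τ, [] => if τ then step π e.2 (false, e.1) else (false, e.1)
  | τ, j :: l => step π (col e.2 (j :: l)) (node π e (!τ) l)

/-- The reduced word of the walk from `(false, i)` to `node π (i, γ) τ l`. -/
def code (γ : Fin (d + 1)) : Bool → List (Fin d) → List (Fin (d + 1))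
  | τ, [] => if τ then [γ] else []
  | τ, j :: l => col γ (j :: l) :: code γ (!τ) l

@[simp] theorem node_fst (π : Fin (d + 1) → Equiv.Perm (Fin N)) (e : Fin N × Fin (d + 1)) (τ : Bool)
    (l : List (Fin d)) : (node π e τ l).1 = τ := by
  induction l generalizing τ with
  | nil => cases τ <;> simp [node]
  | cons j l ih => simp [node, ih]

theorem run_code (π : Fin (d + 1) → Equiv.Perm (Fin N)) (e : Fin N × Fin (d + 1)) (τ : Bool)
    (l : List (Fin d)) : run π (code e.2 τ l) (false, e.1) = node π e τ l := by
  induction l generalizing τ with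
  | nil => cases τ <;> simp [node, code]
  | cons j l ih => simp [node, code, ih]

theorem isChain_cons_code (γ : Fin (d + 1)) (τ : Bool) (l : List (Fin d)) {c : Fin (d + 1)}
    (hc : c ≠ col γ l) : (c :: code γ τ l).IsChain (· ≠ ·) := by
  induction l generalizing τ c with
  | nil => cases τ <;> simp_all [code, col]
  | cons j l ih =>
    rw [code, List.isChain_cons_cons]
    exact ⟨hc, ih _ (Fin.succAbove_ne _ _)⟩

theorem isChain_code (γ : Fin (d + 1)) (τ : Bool) (l : List (Fin d)) :
    (code γ τ l).IsChain (· ≠ ·) := by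
  cases l with
  | nil => cases τ <;> simp [code]
  | cons j l => exact isChain_cons_code γ _ l (Fin.succAbove_ne _ _)

theorem length_code_le (γ : Fin (d + 1)) (τ : Bool) (l : List (Fin d)) :
    (code γ τ l).length ≤ l.length + 1 := by
  induction l generalizing τ with
  | nil => cases τ <;> simp [code]
  | cons j l ih => simpa [code] using ih _

theorem code_injective (γ : Fin (d + 1)) (τ : Bool) : Function.Injective (code γ τ) := by
  intro l l' h
  induction l generalizing τ l' with
  | nil =>
    rcases l' with _ | ⟨j, l'⟩
    · rfl
    · cases τ
      · simp [code] at h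
      · simp only [code, if_true, List.cons.injEq, Bool.not_true] at h
        rcases l' with _ | ⟨j', l'⟩
        · exact (Fin.succAbove_ne _ _ h.1.symm).elim
        · simp [code] at h
  | cons j l ih =>
    rcases l' with _ | ⟨j', l'⟩
    · cases τ
      · simp [code] at h
      · simp only [code, if_true, List.cons.injEq, Bool.not_true] at h
        rcases l with _ | ⟨j', l⟩
        · exact (Fin.succAbove_ne _ _ h.1).elim
        · simp [code] at h
    · simp only [code, List.cons.injEq] at h
      obtain rfl := ih _ h.2
      rw [Fin.succAbove_right_injective h.1]

/-- The radius-`a` balls around the edges in `T` are disjoint trees, and the further edges at the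
vertices with words in `Y` on the side `false` do not lead back to these trees. -/
structure Separated (π : Fin (d + 1) → Equiv.Perm (Fin N)) (a : ℕ) (Y : Finset (List (Fin d)))
    (T : Set (Fin N × Fin (d + 1))) : Prop where
  inj : ∀ e ∈ T, ∀ e' ∈ T, ∀ τ l l', l.length ≤ a → l'.length ≤ a →
    node π e τ l = node π e' τ l' → e = e' ∧ l = l'
  avoid : ∀ e ∈ T, ∀ e' ∈ T, ∀ l ∈ Y, ∀ c ≠ col e.2 l, ∀ l', l'.length ≤ a →
    step π c (node π e false l) ≠ node π e' true l'

/-- The edge of the graph given by a vertex on the side `false` and a colour. -/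
def edge (π : Fin (d + 1) → Equiv.Perm (Fin N)) (e : Fin N × Fin (d + 1)) :
    Sym2 (Bool × Fin N) :=
  s((false, e.1), step π e.2 (false, e.1))

theorem edge_mem_edgeSet {π : Fin (d + 1) → Equiv.Perm (Fin N)} {L a : ℕ}
    {e : Fin N × Fin (d + 1)} (he : Good π L a e.1) : edge π e ∈ (graph π L).edgeSet :=
  ⟨⟨e.2, rfl⟩, he [] (by simp), he [e.2] (by simp)⟩

theorem edge_inj {π : Fin (d + 1) → Equiv.Perm (Fin N)} {L a : ℕ} (hL : 2 ≤ L)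
    {e e' : Fin N × Fin (d + 1)} (he : Good π L a e.1) (h : edge π e = edge π e') : e = e' := by
  simp only [edge, Sym2.eq_iff] at h
  rcases h with ⟨h1, h2⟩ | ⟨h1, -⟩
  · have h3 : e.1 = e'.1 := (Prod.mk.inj h1).2
    rw [← h3] at h2
    have := eq_of_run_eq π (he [] (by simp)) (W := [e.2]) (W' := [e'.2]) (by simp) (by simp)
      (by simpa using hL) h2
    exact Prod.ext h3 (by simpa using this)
  · have := congrArg Prod.fst h1
    simp at this

theorem node_notMem {π : Fin (d + 1) → Equiv.Perm (Fin N)} {L a : ℕ} {e : Fin N × Fin (d + 1)}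
    (he : Good π L a e.1) (τ : Bool) {l : List (Fin d)} (hl : l.length ≤ a) :
    node π e τ l ∉ shortClosed π L := by
  rw [← run_code]
  exact he _ ((length_code_le _ _ _).trans (by omega))

theorem exists_walk_to_edge {π : Fin (d + 1) → Equiv.Perm (Fin N)} {L a : ℕ}
    {e : Fin N × Fin (d + 1)} (he : Good π L a e.1) (τ : Bool) {l : List (Fin d)}
    (hl : l.length ≤ a) :
    ∃ u ∈ edge π e, ∃ p : (graph π L).Walk (node π e τ l) u, p.length = l.length := by
  induction l generalizing τ with
  | nil =>
    refine ⟨node π e τ [], ?_, .nil, rfl⟩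
    cases τ <;> simp [node, edge]
  | cons j l ih =>
    obtain ⟨u, hu, p, hp⟩ := ih (!τ) (by simp at hl; omega)
    have hadj : (graph π L).Adj (node π e τ (j :: l)) (node π e (!τ) l) :=
      ⟨⟨col e.2 (j :: l), by simp [node]⟩, node_notMem he _ hl,
        node_notMem he _ (by simp at hl; omega)⟩
    exact ⟨u, hu, .cons hadj p, by simp [hp]⟩

/-- A common vertex of two balls gives a walk of at most 2a edges, hence distance at most 2a + 1;
one extra edge makes it 2a + 2, usable only if t allows. For a single edge, two descriptions of a
vertex are two reduced words of total length at most 2a + 3 ≤ L, which must coincide. -/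
theorem separated_of_edgeDist {π : Fin (d + 1) → Equiv.Perm (Fin N)} {L a t : ℕ}
    {Y : Finset (List (Fin d))} (ht : 2 * a + 1 ≤ t) (hL : 2 * a + 3 ≤ L)
    (hY : ∀ l ∈ Y, l.length = a ∧ 2 * a + 2 ≤ t) {T : Set (Fin N × Fin (d + 1))}
    (hT : ∀ e ∈ T, Good π L a e.1)
    (hdist : ∀ e ∈ T, ∀ e' ∈ T, e ≠ e' → ¬ (graph π L).edgeDist (edge π e) (edge π e') ≤ t) :
    Separated π a Y T := by
  constructor
  · intro e he e' he' τ l l' hl hl' h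
    have hee : e = e' := by
      by_contra hne
      obtain ⟨u, hu, p, hp⟩ := exists_walk_to_edge (hT e he) τ hl
      obtain ⟨u', hu', p', hp'⟩ := exists_walk_to_edge (hT e' he') τ hl'
      refine hdist e he e' he' hne ((SimpleGraph.edgeDist_le_length_add_one hu hu'
        (p.reverse.append (p'.copy h.symm rfl))).trans ?_)
      simp only [SimpleGraph.Walk.length_append, SimpleGraph.Walk.length_reverse,
        SimpleGraph.Walk.length_copy, hp, hp']
      exact_mod_cast (by omega)
    subst hee
    refine ⟨rfl, code_injective e.2 τ (eq_of_run_eq π (hT e he [] (by simp))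
      (isChain_code _ _ _) (isChain_code _ _ _) ?_ ?_)⟩
    · have := length_code_le e.2 τ l
      have := length_code_le e.2 τ l'
      omega
    · simpa only [run_nil, run_code] using h
  · intro e he e' he' l hl c hc l' hl' h
    obtain ⟨hla, hta⟩ := hY l hl
    have hee : e = e' := by
      by_contra hne
      obtain ⟨u, hu, p, hp⟩ := exists_walk_to_edge (hT e he) false hla.le
      obtain ⟨u', hu', p', hp'⟩ := exists_walk_to_edge (hT e' he') true hl'
      have hadj : (graph π L).Adj (node π e false l) (node π e' true l') :=
        ⟨⟨c, h⟩, node_notMem (hT e he) _ hla.le, node_notMem (hT e' he') _ hl'⟩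
      refine hdist e he e' he' hne ((SimpleGraph.edgeDist_le_length_add_one hu hu'
        (p.reverse.append (.cons hadj p'))).trans ?_)
      simp only [SimpleGraph.Walk.length_append, SimpleGraph.Walk.length_reverse,
        SimpleGraph.Walk.length_cons, hp, hp']
      exact_mod_cast (by omega)
    subst hee
    have heq : c :: code e.2 false l = code e.2 true l' := by
      refine eq_of_run_eq π (hT e he [] (by simp)) (isChain_cons_code _ _ _ hc)
        (isChain_code _ _ _) ?_ ?_
      · have := length_code_le e.2 false l
        have := length_code_le e.2 true l'
        simp only [List.length_cons]
        omega
      · simpa only [run_nil, run_cons, run_code] using h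
    rcases l' with _ | ⟨j, l'⟩
    · simp only [code, if_true, List.cons.injEq] at heq
      rcases l with _ | ⟨j, l⟩
      · exact hc heq.1
      · simp [code] at heq
    -- The words agree only if `l`, of length `a`, is the tail of the other word, which would then
    -- have length `a + 1`.
    · simp only [code, List.cons.injEq, Bool.not_true] at heq
      have := code_injective _ _ heq.2
      subst this
      simp at hl'
      omega

-- Pigeonhole: every good vertex carries `d + 1` edges, all distinct, so some colour class contains
-- more than `m` of them. The isomorphism does not increase distances, so a class of `H` is far
-- apart in `graph π L` too.
open Classical in
theorem exists_separated {π : Fin (d + 1) → Equiv.Perm (Fin N)} {L a t m n : ℕ}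
    {Y : Finset (List (Fin d))} (ht : 2 * a + 1 ≤ t) (hL : 2 * a + 3 ≤ L)
    (hY : ∀ l ∈ Y, l.length = a ∧ 2 * a + 2 ≤ t) {H : SimpleGraph (Fin n)}
    (φ : graph π L ≃g H) (hm : H.distChromaticIndex t * m < #{i | Good π L a i} * (d + 1)) :
    ∃ T : Finset (Fin N × Fin (d + 1)), #T = m ∧
      Separated π a Y (T : Set (Fin N × Fin (d + 1))) := by
  obtain ⟨κ, hκ⟩ := H.exists_isDistEdgeColoring_distChromaticIndex t
  set E : Finset (Fin N × Fin (d + 1)) := ({i | Good π L a i} : Finset (Fin N)) ×ˢ univ with hE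
  have hgood : ∀ e ∈ E, Good π L a e.1 := fun e he => (mem_filter.1 (mem_product.1 he).1).2
  have hmem : ∀ e ∈ E, (edge π e).map φ ∈ H.edgeSet := fun e he =>
    (φ.toHom.map_mem_edgeSet (edge_mem_edgeSet (hgood e he)) : _)
  have hcol : ∃ k : Fin (H.distChromaticIndex t),
      m < #{e ∈ E | ∃ h : (edge π e).map φ ∈ H.edgeSet, κ ⟨_, h⟩ = k} := by
    by_contra! hcon
    have : #E ≤ H.distChromaticIndex t * m := by
      calc #E ≤ #(univ.biUnion fun k : Fin (H.distChromaticIndex t) =>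
            {e ∈ E | ∃ h : (edge π e).map φ ∈ H.edgeSet, κ ⟨_, h⟩ = k}) := by
            refine card_le_card fun e he => mem_biUnion.2 ⟨κ ⟨_, hmem e he⟩, mem_univ _, ?_⟩
            exact mem_filter.2 ⟨he, hmem e he, rfl⟩
        _ ≤ _ := card_biUnion_le
        _ ≤ ∑ k : Fin (H.distChromaticIndex t), m := sum_le_sum fun k _ => hcon k
        _ = _ := by simp
    rw [hE, card_product, card_univ, Fintype.card_fin] at this
    omega
  obtain ⟨k, hk⟩ := hcol
  obtain ⟨T, hT, hcard⟩ := exists_subset_card_eq hk.le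
  refine ⟨T, hcard, separated_of_edgeDist ht hL hY
    (fun e he => hgood e (mem_filter.1 (hT he)).1) ?_⟩
  intro e he e' he' hne hdist
  obtain ⟨heE, h1, hk1⟩ := mem_filter.1 (hT he)
  obtain ⟨heE', h2, hk2⟩ := mem_filter.1 (hT he')
  refine hκ ⟨_, h1⟩ ⟨_, h2⟩ ?_ ?_ (hk1.trans hk2.symm)
  · intro h
    have h' : (edge π e).map φ = (edge π e').map φ := congrArg Subtype.val h
    exact hne (edge_inj (by omega) (hgood e heE) (Sym2.map.injective φ.injective h'))
  · refine le_trans ?_ hdist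
    refine le_iInf fun u => le_iInf fun v => le_iInf fun hu => le_iInf fun hv =>
      le_iInf fun p => le_iInf fun hp => ?_
    refine (SimpleGraph.edgeDist_le_length_add_one (Sym2.mem_map.2 ⟨u, hu, rfl⟩)
      (Sym2.mem_map.2 ⟨v, hv, rfl⟩) (p.map φ.toHom)).trans ?_
    rw [SimpleGraph.Walk.length_map, SimpleGraph.Walk.length_support]

end PermGraph

/-! ### First moment of separated configurations -/

namespace PermGraph

open Finset

variable {d N : ℕ}

theorem step_false (π : Fin (d + 1) → Equiv.Perm (Fin N)) (c : Fin (d + 1)) {u v : Bool × Fin N}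
    (hu : u.1 = false) (h : step π c u = v) : π c u.2 = v.2 := by
  subst h
  simp [step, hu]

theorem tail_mem_words {κ : Type*} [Fintype κ] [DecidableEq κ] {a : ℕ} {l : List κ}
    (h : l ∈ words κ a) : l.tail ∈ words κ a := by
  rw [mem_words] at h ⊢
  simp
  omega

/-- The vertices on one side of the balls of radius `a` around `m` edges. -/
abbrev Ball (d a m : ℕ) : Type := Fin m × {l : List (Fin d) // l ∈ words (Fin d) a}

/-- The labelling `π` has separated balls around `m` edges with colours `γ` and vertices `φ`. -/
def Realizes (a : ℕ) {m : ℕ} (Y : Finset (List (Fin d))) (γ : Fin m → Fin (d + 1))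
    (φ : Bool → Ball d a m ↪ Fin N) (π : Fin (d + 1) → Equiv.Perm (Fin N)) : Prop :=
  ∃ e : Fin m → Fin N × Fin (d + 1), (∀ k, (e k).2 = γ k) ∧
    (∀ τ x, node π (e x.1) τ x.2 = (τ, φ τ x)) ∧ Separated π a Y (Set.range e)

-- Once the ball vertices are named, the labelling has `2w - 1` prescribed edges per tree (`A`),
-- while the `d` other edges at each `Y`-vertex (`P`) must miss the ball vertices on the side `true`
-- (`S`). `K` bounds the prescribed edges of one colour.
open Classical in
theorem card_realizes_le {a m K : ℕ} (Y : Finset (List (Fin d))) (hY : Y ⊆ words (Fin d) a)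
    (hK : K = m * (2 * #{l ∈ words (Fin d) a | l.length < a} + 1)) (hKN : K < N)
    (hKw : K ≤ m * #(words (Fin d) a)) (γ : Fin m → Fin (d + 1)) (φ : Bool → Ball d a m ↪ Fin N) :
    (#{π | Realizes a Y γ φ π} : ℝ) ≤
      (N.factorial : ℝ) ^ (d + 1) * ((N : ℝ) - K)⁻¹ ^ (m * (2 * #(words (Fin d) a) - 1)) *
        Real.exp (-(((m * #Y * d : ℕ) * (m * #(words (Fin d) a) : ℕ) -
          (m * #Y : ℕ) * (m * (2 * #(words (Fin d) a) - 1) : ℕ)) / N)) := by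
  set w := #(words (Fin d) a) with hw
  have hball : Fintype.card (Ball d a m) = m * w := by simp [hw]
  set nil : {l : List (Fin d) // l ∈ words (Fin d) a} := ⟨[], mem_words.2 (by simp)⟩ with hnil
  -- One edge for each vertex, to its parent; `(true, [])` is dropped because `(false, [])` already
  -- gives the central edge.
  set E : Finset (Fin m × (Bool × {l : List (Fin d) // l ∈ words (Fin d) a})) :=
    univ ×ˢ univ.erase (true, nil) with hE
  have hEcard : #E = m * (2 * w - 1) := by
    rw [hE, card_product, card_erase_of_mem (mem_univ _)]
    simp [hw]
  set tl : {l : List (Fin d) // l ∈ words (Fin d) a} → {l : List (Fin d) // l ∈ words (Fin d) a} :=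
    fun l => ⟨l.1.tail, tail_mem_words l.2⟩ with htl
  set f : Fin m × (Bool × {l : List (Fin d) // l ∈ words (Fin d) a}) →
      Fin (d + 1) × (Fin N × Fin N) := fun x =>
    (col (γ x.1) x.2.2, (φ false (x.1, if x.2.1 then tl x.2.2 else x.2.2),
      φ true (x.1, if x.2.1 then x.2.2 else tl x.2.2))) with hf
  have hne : ∀ x ∈ E, ¬ (x.2.1 = true ∧ x.2.2.1 = []) := by
    rintro ⟨k, τ, l⟩ hx ⟨h1, h2⟩
    simp only [hE, mem_product, mem_univ, mem_erase, true_and, and_true] at hx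
    exact hx (Prod.ext h1 (Subtype.ext h2))
  have hfinj : Set.InjOn f E := by
    rintro ⟨k, τ, l⟩ hx ⟨k', τ', l'⟩ hx' h
    have h1 := hne _ hx
    have h2 := hne _ hx'
    simp only [hf, Prod.mk.injEq, EmbeddingLike.apply_eq_iff_eq] at h
    obtain ⟨-, ⟨rfl, h3⟩, ⟨-, h4⟩⟩ := h
    have htt : ∀ l₁ l₂ : {l : List (Fin d) // l ∈ words (Fin d) a}, tl l₁ = l₂ → l₁ = tl l₂ →
        l₁.1 = [] ∧ l₂.1 = [] := by
      rintro l₁ l₂ rfl h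
      have := congrArg (fun l => l.1.length) h
      simp only [htl, List.length_tail] at this
      have h0 : l₁.1 = [] := List.length_eq_zero_iff.1 (by omega)
      exact ⟨h0, by simp [htl, h0]⟩
    cases τ <;> cases τ'
    · exact congrArg (fun l => (k, false, l)) h3
    · exact (h2 ⟨rfl, (htt _ _ h3.symm h4.symm).1⟩).elim
    · exact (h1 ⟨rfl, (htt _ _ h3 h4).1⟩).elim
    · exact congrArg (fun l => (k, true, l)) h4
  set A := E.image f with hA
  have hAcard : #A = m * (2 * w - 1) := by rw [hA, card_image_of_injOn hfinj, hEcard]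
  set S : Finset (Fin N) := univ.image (φ true) with hS
  have hScard : #S = m * w := by
    rw [hS, card_image_of_injective _ (φ true).injective, card_univ, hball]
  set g : Fin m × {l // l ∈ Y} × Fin d → Fin (d + 1) × Fin N := fun q =>
    ((col (γ q.1) q.2.1).succAbove q.2.2, φ false (q.1, ⟨q.2.1, hY q.2.1.2⟩)) with hg
  have hginj : Function.Injective g := by
    rintro ⟨k, l, j⟩ ⟨k', l', j'⟩ h
    simp only [hg, Prod.mk.injEq, EmbeddingLike.apply_eq_iff_eq, Subtype.mk.injEq] at h
    obtain ⟨h1, rfl, h2⟩ := h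
    have h3 := Subtype.ext h2
    subst h3
    rw [Fin.succAbove_right_injective h1]
  set P := univ.image g with hP
  have hPcard : #P = m * #Y * d := by
    rw [hP, card_image_of_injective _ hginj, card_univ]
    simp [mul_assoc]
  have hfib : ∀ c, #{p ∈ A | p.1 = c} ≤ K := by
    intro c
    have h1 : #{p ∈ A | p.1 = c} ≤ #{x ∈ E | col (γ x.1) x.2.2 = c} := by
      rw [hA, filter_image]
      exact card_image_le
    refine h1.trans ?_
    -- With the colour fixed, an edge is determined by its tree, side and parent word, of length
    -- below `a`; `none` stands for the central edge.
    set short : Finset (List (Fin d)) := {u ∈ words (Fin d) a | u.length < a} with hshort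
    have h2 : Fintype.card (Fin m × Option (Bool × {u // u ∈ short})) = K := by
      rw [hK, Fintype.card_prod, Fintype.card_option, Fintype.card_prod, Fintype.card_coe]
      simp
    rw [← h2, ← card_univ]
    refine card_le_card_of_injOn (fun x => (x.1, if h : x.2.2.1 = [] then none else
      some (x.2.1, ⟨x.2.2.1.tail, mem_filter.2 ⟨tail_mem_words x.2.2.2, ?_⟩⟩)))
      (fun _ _ => mem_coe.2 (mem_univ _)) ?_
    · have := mem_words.1 x.2.2.2
      have := List.length_pos_iff.2 h
      rw [List.length_tail]
      omega
    · rintro ⟨k, τ, l, hl⟩ hx ⟨k', τ', l', hl'⟩ hx' h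
      obtain ⟨hx, hc⟩ := mem_filter.1 hx
      obtain ⟨hx', hc'⟩ := mem_filter.1 hx'
      have h3 := hne _ hx
      have h4 := hne _ hx'
      simp only [Prod.mk.injEq] at h
      obtain ⟨rfl, h⟩ := h
      rcases l with _ | ⟨j, l⟩ <;> rcases l' with _ | ⟨j', l'⟩
      · cases τ
        · cases τ'
          · rfl
          · exact (h4 ⟨rfl, rfl⟩).elim
        · exact (h3 ⟨rfl, rfl⟩).elim
      · simp at h
      · simp at h
      · simp only [reduceCtorEq, ↓reduceDIte, List.tail_cons, Option.some.injEq, Prod.mk.injEq,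
          Subtype.mk.injEq] at h
        obtain ⟨rfl, rfl⟩ := h
        have := Fin.succAbove_right_injective (hc.trans hc'.symm)
        subst this
        rfl
  have hlam : ∀ c, #{q ∈ P | q.1 = c} ≤ m * #Y := by
    intro c
    have : {q ∈ P | q.1 = c} ⊆ univ.image fun q : Fin m × {l // l ∈ Y} =>
        (c, φ false (q.1, ⟨q.2, hY q.2.2⟩)) := by
      intro q hq
      obtain ⟨hq', rfl⟩ := mem_filter.1 hq
      obtain ⟨x, -, rfl⟩ := mem_image.1 hq'
      exact mem_image.2 ⟨(x.1, x.2.1), mem_univ _, rfl⟩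
    refine (card_le_card this).trans (card_image_le.trans_eq ?_)
    rw [card_univ]
    simp
  have hAS : ∀ p ∈ A, p.2.2 ∈ S := by
    intro p hp
    obtain ⟨x, -, rfl⟩ := mem_image.1 hp
    exact mem_image_of_mem _ (mem_univ _)
  have key := card_labelling_le A P S hAS hKN (hKw.trans_eq hScard.symm) hfib hlam
  rw [hAcard, hPcard, hScard, Fintype.card_fin] at key
  refine le_trans ?_ key
  norm_cast
  refine card_le_card fun π hπ => ?_
  obtain ⟨e, hγ, hnode, hsep⟩ := (mem_filter.1 hπ).2
  refine mem_filter.2 ⟨mem_univ _, ?_, ?_⟩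
  · intro p hp
    obtain ⟨⟨k, τ, l⟩, hx, rfl⟩ := mem_image.1 hp
    have hx := hne _ hx
    have hstep : step π (col (γ k) l) (false, φ false (k, if τ then tl l else l)) =
        (true, φ true (k, if τ then l else tl l)) := by
      rw [← hnode, ← hnode, ← hγ]
      obtain ⟨l, hl⟩ := l
      rcases l with _ | ⟨j, l⟩ <;> cases τ
      · simp [htl, node, col]
      · exact (hx ⟨rfl, rfl⟩).elim
      · simp [htl, node]
      · simp [htl, node]
    exact step_false π _ rfl hstep
  · intro q hq hmem
    obtain ⟨⟨k, l, j⟩, -, rfl⟩ := mem_image.1 hq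
    obtain ⟨⟨k', l'⟩, -, h⟩ := mem_image.1 hmem
    refine hsep.avoid (e k) ⟨k, rfl⟩ (e k') ⟨k', rfl⟩ l l.2 ((col (γ k) l).succAbove j) ?_ l'
      (mem_words.1 l'.2) ?_
    · rw [hγ]
      exact Fin.succAbove_ne _ _
    · have h1 := hnode false (k, ⟨l, hY l.2⟩)
      have h2 := hnode true (k', l')
      simp only at h1 h2
      rw [h1, h2, h]
      simp [step, hg]

-- A set of `m` edges has `m!` enumerations; then take a union bound over the colours of the edges
-- and the positions of the ball vertices. Disjointness enters as falling factorials in place of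
-- powers of `N`.
open Classical in
theorem card_separated_mul_factorial_le {a m K : ℕ} (Y : Finset (List (Fin d)))
    (hY : Y ⊆ words (Fin d) a)
    (hK : K = m * (2 * #{l ∈ words (Fin d) a | l.length < a} + 1)) (hKN : K < N)
    (hKw : K ≤ m * #(words (Fin d) a)) :
    (#{π : Fin (d + 1) → Equiv.Perm (Fin N) | ∃ T : Finset (Fin N × Fin (d + 1)), #T = m ∧
        Separated π a Y (T : Set (Fin N × Fin (d + 1)))} : ℝ) * m.factorial ≤
      ((d : ℝ) + 1) ^ m * (N.descFactorial (m * #(words (Fin d) a)) : ℝ) ^ 2 *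
      ((N.factorial : ℝ) ^ (d + 1) * ((N : ℝ) - K)⁻¹ ^ (m * (2 * #(words (Fin d) a) - 1)) *
        Real.exp (-(((m * #Y * d : ℕ) * (m * #(words (Fin d) a) : ℕ) -
          (m * #Y : ℕ) * (m * (2 * #(words (Fin d) a) - 1) : ℕ)) / N))) := by
  set w := #(words (Fin d) a) with hw
  set D : Finset (Fin (d + 1) → Equiv.Perm (Fin N)) :=
    {π | ∃ T : Finset (Fin N × Fin (d + 1)), #T = m ∧
        Separated π a Y (T : Set (Fin N × Fin (d + 1)))} with hD
  set Q : Finset ((Fin (d + 1) → Equiv.Perm (Fin N)) × (Fin m → Fin N × Fin (d + 1))) :=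
    {p | Function.Injective p.2 ∧ Separated p.1 a Y (Set.range p.2)} with hQ
  have h1 : #D * m.factorial ≤ #Q := by
    have hT : ∀ π : {π // π ∈ D}, ∃ e : Fin m → Fin N × Fin (d + 1), Function.Injective e ∧
        Separated π.1 a Y (Set.range e) := by
      rintro ⟨π, hπ⟩
      obtain ⟨T, hT, hs⟩ := (mem_filter.1 hπ).2
      refine ⟨fun k => ((T.equivFinOfCardEq hT).symm k).1,
        Subtype.val_injective.comp (Equiv.injective _), ?_⟩
      convert hs
      ext x
      constructor
      · rintro ⟨k, rfl⟩
        exact Subtype.coe_prop _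
      · intro hx
        exact ⟨T.equivFinOfCardEq hT ⟨x, hx⟩, by simp⟩
    choose e he hsep using hT
    have : #D * m.factorial = Fintype.card ({π // π ∈ D} × Equiv.Perm (Fin m)) := by
      rw [Fintype.card_prod, Fintype.card_perm, Fintype.card_coe, Fintype.card_fin]
    rw [this, ← card_univ]
    refine card_le_card_of_injOn (fun p => (p.1.1, e p.1 ∘ p.2)) ?_ ?_
    · rintro ⟨π, σ⟩ -
      refine mem_filter.2 ⟨mem_univ _, (he π).comp σ.injective, ?_⟩
      rw [EquivLike.range_comp]
      exact hsep π
    · rintro ⟨π, σ⟩ - ⟨π', σ'⟩ - h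
      simp only [Prod.mk.injEq] at h
      obtain ⟨h1, h2⟩ := h
      have h1 := Subtype.ext h1
      subst h1
      have : σ = σ' := Equiv.ext fun k => he π (congrFun h2 k)
      rw [this]
  have h2 : #Q ≤ #((univ : Finset ((Fin m → Fin (d + 1)) × (Bool → Ball d a m ↪ Fin N))).sigma
      fun s => ({π | Realizes a Y s.1 s.2 π} : Finset (Fin (d + 1) → Equiv.Perm (Fin N)))) := by
    rw [← Fintype.card_coe Q, ← card_univ]
    have hemb : ∀ p : {p // p ∈ Q}, ∀ τ, Function.Injective fun x : Ball d a m =>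
        (node p.1.1 (p.1.2 x.1) τ x.2).2 := by
      rintro ⟨p, hp⟩ τ x y h
      obtain ⟨hinj, hs⟩ := (mem_filter.1 hp).2
      have := hs.inj _ ⟨x.1, rfl⟩ _ ⟨y.1, rfl⟩ τ x.2 y.2 (mem_words.1 x.2.2) (mem_words.1 y.2.2)
        (Prod.ext (by simp) h)
      exact Prod.ext (hinj this.1) (Subtype.ext this.2)
    refine card_le_card_of_injOn (fun p => ⟨(fun k => (p.1.2 k).2, fun τ => ⟨_, hemb p τ⟩), p.1.1⟩)
      ?_ ?_
    · intro p _
      obtain ⟨hinj, hs⟩ := (mem_filter.1 p.2).2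
      refine mem_sigma.2 ⟨mem_univ _, mem_filter.2 ⟨mem_univ _, p.1.2, fun k => rfl, ?_, hs⟩⟩
      intro τ x
      exact Prod.ext (by simp) rfl
    · rintro ⟨p, hp⟩ - ⟨q, hq⟩ - h
      simp only [Sigma.mk.injEq, Prod.mk.injEq, heq_eq_eq] at h
      obtain ⟨⟨h1, h2⟩, h3⟩ := h
      refine Subtype.ext (Prod.ext h3 (funext fun k => Prod.ext ?_ (congrFun h1 k)))
      have := DFunLike.congr_fun (congrFun h2 false) (k, ⟨[], mem_words.2 (by simp)⟩)
      simpa [node] using this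
  have hball : Fintype.card (Ball d a m) = m * w := by simp [hw]
  calc (#D : ℝ) * m.factorial = ((#D * m.factorial : ℕ) : ℝ) := by push_cast; rfl
    _ ≤ ((#((univ : Finset ((Fin m → Fin (d + 1)) × (Bool → Ball d a m ↪ Fin N))).sigma
      fun s => ({π | Realizes a Y s.1 s.2 π} : Finset (Fin (d + 1) → Equiv.Perm (Fin N)))) : ℕ) :
        ℝ) := by exact_mod_cast h1.trans h2
    _ = ∑ s : (Fin m → Fin (d + 1)) × (Bool → Ball d a m ↪ Fin N),
        (#{π | Realizes a Y s.1 s.2 π} : ℝ) := by rw [card_sigma]; push_cast; rfl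
    _ ≤ ∑ s : (Fin m → Fin (d + 1)) × (Bool → Ball d a m ↪ Fin N), _ :=
        sum_le_sum fun s _ => card_realizes_le Y hY hK hKN hKw s.1 s.2
    _ = _ := by
        rw [sum_const, card_univ, nsmul_eq_mul]
        congr 1
        simp only [Fintype.card_prod, Fintype.card_fun, Fintype.card_fin,
          Fintype.card_embedding_eq, Fintype.card_bool, hball]
        push_cast
        rfl

end PermGraph

/-! ### Ball sizes and the exponent -/

namespace PermGraph

open Finset

section Words

variable {κ : Type*} [Fintype κ] [DecidableEq κ]

theorem pow_le_card_words (a : ℕ) : Fintype.card κ ^ a ≤ #(words κ a) := by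
  induction a with
  | zero => simp [words]
  | succ a ih =>
    rw [card_words_succ, pow_succ, mul_comm]
    exact (Nat.mul_le_mul_left _ ih).trans (by omega)

theorem card_words_add_one_le (h : 2 ≤ Fintype.card κ) (a : ℕ) :
    #(words κ a) + 1 ≤ 2 * Fintype.card κ ^ a := by
  induction a with
  | zero => simp [words]
  | succ a ih =>
    rw [card_words_succ, pow_succ]
    nlinarith

theorem filter_length_lt_words (a : ℕ) :
    {l ∈ words κ (a + 1) | l.length < a + 1} = words κ a := by
  ext l
  simp only [mem_filter, mem_words]
  omega

theorem card_filter_length_words_add (a : ℕ) :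
    #{l ∈ words κ a | l.length = a} + #{l ∈ words κ a | l.length < a} = #(words κ a) := by
  rw [← card_filter_add_card_filter_not (s := words κ a) (fun l => l.length = a)]
  congr 2
  refine filter_congr fun l hl => ?_
  rw [mem_words] at hl
  omega

end Words

/-- The parameters of the balls for distance `t`, and the bounds on their sizes. -/
theorem exists_ball_parameters {d t : ℕ} (hd : 2 ≤ d) (ht : 2 ≤ t) :
    ∃ (a : ℕ) (Y : Finset (List (Fin d))), Y ⊆ words (Fin d) a ∧ 2 * a + 1 ≤ t ∧
      (∀ l ∈ Y, l.length = a ∧ 2 * a + 2 ≤ t) ∧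
      2 * #{l ∈ words (Fin d) a | l.length < a} + 1 ≤ #(words (Fin d) a) ∧
      #(words (Fin d) a) * (2 * #{l ∈ words (Fin d) a | l.length < a} + 1) ≤ 10 * d ^ (t - 2) ∧
      (d - 2) ^ (t - 1) ≤ #(words (Fin d) a) ^ 2 + #Y * #(words (Fin d) a) * (d - 2) := by
  have hcard : Fintype.card (Fin d) = d := Fintype.card_fin d
  have hd' : 2 ≤ Fintype.card (Fin d) := by omega
  have hsub : (d - 2) ≤ d := Nat.sub_le _ _
  have hd1 : 1 ≤ d := by omega
  have hshort : ∀ a, 2 * #{l ∈ words (Fin d) a | l.length < a} + 1 ≤ #(words (Fin d) a) := by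
    rintro (_ | a)
    · simp [words]
    · rw [filter_length_lt_words, card_words_succ, hcard]
      nlinarith
  have hprod : ∀ a, #(words (Fin d) (a + 1)) *
      (2 * #{l ∈ words (Fin d) (a + 1) | l.length < a + 1} + 1) ≤ 10 * d ^ (2 * a + 1) := by
    intro a
    have h1 := card_words_add_one_le hd' (a + 1)
    have h2 := card_words_add_one_le hd' a
    rw [hcard] at h1 h2
    rw [filter_length_lt_words]
    calc _ ≤ (2 * d ^ (a + 1)) * (4 * d ^ a) := Nat.mul_le_mul (by omega) (by omega)
      _ = 8 * d ^ (2 * a + 1) := by ring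
      _ ≤ _ := by gcongr; norm_num
  -- For odd t the radius is (t-1)/2 and w² alone has order d^(t-1). For even t it falls short by a
  -- factor d, which the edges leaving the leaves `Y` supply.
  rcases Nat.even_or_odd' t with ⟨b, rfl | rfl⟩
  · obtain ⟨a, rfl⟩ : ∃ a, b = a + 1 := ⟨b - 1, by omega⟩
    refine ⟨a, {l ∈ words (Fin d) a | l.length = a}, filter_subset _ _, by omega,
      fun l hl => ⟨(mem_filter.1 hl).2, by omega⟩, hshort a, ?_, ?_⟩
    · rcases a with _ | a
      · simp [words]
      · refine (hprod a).trans ?_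
        gcongr
        all_goals omega
    · have hw := pow_le_card_words (κ := Fin d) a
      have hy : (d - 2) ^ a ≤ #{l ∈ words (Fin d) a | l.length = a} := by
        rcases a with _ | a
        · exact card_pos.2 ⟨[], by simp [words]⟩
        · have h1 := card_filter_length_words_add (κ := Fin d) (a + 1)
          have h2 := pow_le_card_words (κ := Fin d) a
          rw [filter_length_lt_words, card_words_succ, hcard] at h1
          rw [hcard] at h2
          obtain ⟨e, rfl⟩ : ∃ e, d = e + 2 := ⟨d - 2, by omega⟩
          have h3 : e ^ (a + 1) ≤ (e + 1) * #(words (Fin (e + 2)) a) := by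
            rw [pow_succ, mul_comm]
            exact Nat.mul_le_mul (by omega) ((Nat.pow_le_pow_left (by omega) a).trans h2)
          rw [Nat.add_sub_cancel]
          nlinarith
      rw [hcard] at hw
      calc (d - 2) ^ (2 * (a + 1) - 1) = (d - 2) ^ a * (d - 2) ^ a * (d - 2) := by
            rw [show 2 * (a + 1) - 1 = a + a + 1 by omega, pow_succ, pow_add]
        _ ≤ #{l ∈ words (Fin d) a | l.length = a} * #(words (Fin d) a) * (d - 2) :=
            Nat.mul_le_mul_right _ (Nat.mul_le_mul hy ((Nat.pow_le_pow_left hsub a).trans hw))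
        _ ≤ _ := Nat.le_add_left _ _
  · obtain ⟨a, rfl⟩ : ∃ a, b = a + 1 := ⟨b - 1, by omega⟩
    refine ⟨a + 1, ∅, empty_subset _, by omega, by simp, hshort _, ?_, ?_⟩
    · refine (hprod a).trans_eq ?_
      congr 2
    · have hw := pow_le_card_words (κ := Fin d) (a + 1)
      rw [hcard] at hw
      calc (d - 2) ^ (2 * (a + 1) + 1 - 1) = ((d - 2) ^ (a + 1)) ^ 2 := by
            rw [← pow_mul]; congr 1; omega
        _ ≤ _ := Nat.pow_le_pow_left ((Nat.pow_le_pow_left hsub _).trans hw) 2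
        _ ≤ _ := Nat.le_add_right _ _

theorem inv_one_sub_le_exp {x : ℝ} (h0 : 0 ≤ x) (h : x ≤ 1 / 2) :
    (1 - x)⁻¹ ≤ Real.exp (2 * x) := by
  rw [inv_le_iff_one_le_mul₀ (by linarith)]
  have := Real.add_one_le_exp (2 * x)
  nlinarith

/-- The bound on the number of separated configurations, relative to all labellings. -/
theorem count_bound_le_exp {Δ N m w y e K : ℝ} {mn wn : ℕ} (hm : m = mn) (hw : w = wn)
    (hmn : 0 < mn) (hwn : 0 < wn) (hN : 0 < N) (hΔ : 0 < Δ) (hK0 : 0 ≤ K) (hKN : K ≤ N / 2)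
    (hexp : 1 + Real.log (Δ * N / m) + 4 * K * w / N - w * (m * w - 1) / N - m * y * (e * w) / N ≤
      -1) {D : ℝ} (hD : D ≤ N ^ (mn * wn) * Real.exp (-((m * w) * (m * w - 1) / (2 * N))))
    (hD0 : 0 ≤ D) :
    Δ ^ mn * D ^ 2 * ((N - K)⁻¹ ^ (mn * (2 * wn - 1)) *
      Real.exp (-(m * y * (m * (e * w)) / N))) ≤
      mn.factorial * Real.exp (-m) := by
  have hm0 : 0 < m := by rw [hm]; exact_mod_cast hmn
  have hw0 : 0 < w := by rw [hw]; exact_mod_cast hwn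
  have hNK : (N - K)⁻¹ ≤ N⁻¹ * Real.exp (2 * (K / N)) := by
    have h1 : N - K = N * (1 - K / N) := by field_simp
    rw [h1, mul_inv]
    refine mul_le_mul_of_nonneg_left (inv_one_sub_le_exp (by positivity) ?_) (by positivity)
    rw [div_le_iff₀ hN]; linarith
  have hNK0 : 0 ≤ (N - K)⁻¹ := inv_nonneg.2 (by linarith)
  have h2w : ((2 * wn - 1 : ℕ) : ℝ) = 2 * w - 1 := by
    rw [Nat.cast_sub (by omega), hw]; push_cast; ring
  have hA : (N - K)⁻¹ ^ (mn * (2 * wn - 1)) ≤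
      N⁻¹ ^ (mn * (2 * wn - 1)) * Real.exp (m * (4 * K * w / N)) := by
    refine (pow_le_pow_left₀ hNK0 hNK _).trans ?_
    rw [mul_pow, ← Real.exp_nat_mul]
    refine mul_le_mul_of_nonneg_left (Real.exp_le_exp.2 ?_) (by positivity)
    rw [Nat.cast_mul, h2w, ← hm]
    have : m * (4 * K * w / N) - m * (2 * w - 1) * (2 * (K / N)) = m * (2 * (K / N)) := by
      field_simp; ring
    have : 0 ≤ m * (2 * (K / N)) := by positivity
    linarith
  have hB : D ^ 2 ≤ N ^ (2 * (mn * wn)) * Real.exp (-(m * (w * (m * w - 1) / N))) := by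
    refine (pow_le_pow_left₀ hD0 hD 2).trans_eq ?_
    rw [mul_pow, ← pow_mul, mul_comm (mn * wn), ← Real.exp_nat_mul]
    congr 2
    push_cast
    field_simp
  -- A tree has one vertex more than it has edges, so each tree leaves one factor `N`.
  have hpow : N ^ (2 * (mn * wn)) * N⁻¹ ^ (mn * (2 * wn - 1)) = N ^ mn := by
    rw [show 2 * (mn * wn) = mn + mn * (2 * wn - 1) by
      obtain ⟨v, rfl⟩ : ∃ v, wn = v + 1 := ⟨wn - 1, by omega⟩
      rw [show 2 * (v + 1) - 1 = 2 * v + 1 by omega]; ring, pow_add, mul_assoc, ← mul_pow,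
      mul_inv_cancel₀ hN.ne', one_pow, mul_one]
  have hfac : m ^ mn ≤ mn.factorial * Real.exp m := by
    have := Real.pow_div_factorial_le_exp m hm0.le mn
    rwa [div_le_iff₀ (by positivity), mul_comm] at this
  have hlog : (Δ * N) ^ mn = m ^ mn * Real.exp (m * Real.log (Δ * N / m)) := by
    have h1 : 0 < Δ * N / m := by positivity
    rw [hm, Real.exp_nat_mul, ← hm, Real.exp_log h1, ← mul_pow, mul_div_cancel₀ _ hm0.ne']
  calc _ ≤ Δ ^ mn * (N ^ (2 * (mn * wn)) * Real.exp (-(m * (w * (m * w - 1) / N)))) *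
        ((N⁻¹ ^ (mn * (2 * wn - 1)) * Real.exp (m * (4 * K * w / N))) *
          Real.exp (-(m * y * (m * (e * w)) / N))) := by gcongr
    _ = (Δ * N) ^ mn * Real.exp (m * (4 * K * w / N - w * (m * w - 1) / N -
          m * y * (e * w) / N)) := by
        rw [mul_pow, ← hpow, show m * (4 * K * w / N - w * (m * w - 1) / N - m * y * (e * w) / N) =
          -(m * (w * (m * w - 1) / N)) + m * (4 * K * w / N) + -(m * y * (m * (e * w)) / N) by
            field_simp; ring, Real.exp_add, Real.exp_add]
        ring
    _ ≤ mn.factorial * Real.exp m * Real.exp (m * Real.log (Δ * N / m)) *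
          Real.exp (m * (4 * K * w / N - w * (m * w - 1) / N - m * y * (e * w) / N)) := by
        rw [hlog]; gcongr
    _ = mn.factorial * Real.exp (m * (1 + Real.log (Δ * N / m) + 4 * K * w / N -
          w * (m * w - 1) / N - m * y * (e * w) / N)) := by
        rw [mul_assoc, mul_assoc, ← Real.exp_add, ← Real.exp_add]
        congr 2
        ring
    _ ≤ _ := by
        refine mul_le_mul_of_nonneg_left (Real.exp_le_exp.2 ?_) (by positivity)
        nlinarith

end PermGraph

/-! ### Choosing a labelling and building the graph -/

namespace PermGraph

open Finset

open Classical in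
/-- A labelling with few vertices on short closed walks and no large separated set of edges. -/
theorem exists_labelling {d N L a m R : ℕ} {Y : Finset (List (Fin d))}
    (hL : 2 * L ≤ N) (hR : R = 2 * (#(words (Fin (d + 1)) L) * 4 ^ L))
    (hsep : (#{π : Fin (d + 1) → Equiv.Perm (Fin N) | ∃ T : Finset (Fin N × Fin (d + 1)), #T = m ∧
        Separated π a Y (T : Set (Fin N × Fin (d + 1)))} : ℝ) < (N.factorial : ℝ) ^ (d + 1) / 2) :
    ∃ π : Fin (d + 1) → Equiv.Perm (Fin N), #{v | v ∈ shortSimpleClosed π L} ≤ R ∧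
      ¬ ∃ T : Finset (Fin N × Fin (d + 1)), #T = m ∧
        Separated π a Y (T : Set (Fin N × Fin (d + 1))) := by
  by_contra! hcon
  set S₁ : Finset (Fin (d + 1) → Equiv.Perm (Fin N)) :=
    {π | ∃ T : Finset (Fin N × Fin (d + 1)), #T = m ∧
        Separated π a Y (T : Set (Fin N × Fin (d + 1)))}
  set S₂ : Finset (Fin (d + 1) → Equiv.Perm (Fin N)) :=
    {π | R < #{v | v ∈ shortSimpleClosed π L}} with hS₂
  have hun : (univ : Finset (Fin (d + 1) → Equiv.Perm (Fin N))) ⊆ S₁ ∪ S₂ := by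
    intro π _
    rw [mem_union]
    by_cases h : #{v | v ∈ shortSimpleClosed π L} ≤ R
    · exact Or.inl (mem_filter.2 ⟨mem_univ _, hcon π h⟩)
    · exact Or.inr (mem_filter.2 ⟨mem_univ _, not_le.1 h⟩)
  have hcard : ((N.factorial : ℝ) ^ (d + 1)) ≤ #S₁ + #S₂ := by
    have h1 := (card_le_card hun).trans (card_union_le _ _)
    rw [card_univ, Fintype.card_fun, Fintype.card_perm, Fintype.card_fin, Fintype.card_fin] at h1
    exact_mod_cast h1
  -- `R` is twice the bound on the mean, so by Markov's inequality at most half of the labellings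
  -- exceed it.
  have hmarkov : (#S₂ : ℝ) * R ≤ R / 2 * (N.factorial : ℝ) ^ (d + 1) := by
    have h1 := sum_card_shortSimpleClosed_le (C := Fin (d + 1)) hL
    rw [Fintype.card_fin] at h1
    calc (#S₂ : ℝ) * R = ∑ π ∈ S₂, (R : ℝ) := by rw [sum_const, nsmul_eq_mul]
      _ ≤ ∑ π ∈ S₂, (#{v | v ∈ shortSimpleClosed π L} : ℝ) :=
          sum_le_sum fun π hπ => by exact_mod_cast (mem_filter.1 hπ).2.le
      _ ≤ ∑ π, (#{v | v ∈ shortSimpleClosed π L} : ℝ) :=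
          sum_le_sum_of_subset_of_nonneg (subset_univ _) fun _ _ _ => Nat.cast_nonneg _
      _ ≤ _ := h1
      _ = _ := by rw [hR]; push_cast; ring
  have hRpos : (0 : ℝ) < R := by
    have : 0 < #(words (Fin (d + 1)) L) := card_pos.2 ⟨[], mem_words.2 (by simp)⟩
    rw [hR]
    positivity
  have : (#S₂ : ℝ) ≤ (N.factorial : ℝ) ^ (d + 1) / 2 := by
    refine le_of_mul_le_mul_right ?_ hRpos
    linarith
  linarith

-- In `hmain` the logarithm is the entropy, `40 * d ^ (t - 2)` pays for replacing 1/N by 1/(N-K),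
-- and the right side is the gain. The 3 is one from m^m ≤ m! e^m, one for w/N ≤ 1 and one for the
-- final factor e^(-m).
open Classical in
theorem card_separated_lt {d N a m t : ℕ} {Y : Finset (List (Fin d))} {μ : ℝ} (hd : 2 ≤ d)
    (hY : Y ⊆ words (Fin d) a)
    (h1 : 2 * #{l ∈ words (Fin d) a | l.length < a} + 1 ≤ #(words (Fin d) a))
    (h2 : #(words (Fin d) a) * (2 * #{l ∈ words (Fin d) a | l.length < a} + 1) ≤ 10 * d ^ (t - 2))
    (h3 : (d - 2) ^ (t - 1) ≤ #(words (Fin d) a) ^ 2 + #Y * #(words (Fin d) a) * (d - 2))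
    (hμ : 0 < μ) (hμ1 : 80 * μ * d ^ (t - 2) ≤ 1)
    (hmain : 3 + Real.log ((d + 1) / μ) + μ * (40 * d ^ (t - 2)) ≤ μ * ((d : ℝ) - 2) ^ (t - 1))
    (hm : μ * N ≤ m) (hm' : m ≤ μ * N + 1)
    (hNw : 4 * #(words (Fin d) a) ≤ N) :
    (#{π : Fin (d + 1) → Equiv.Perm (Fin N) | ∃ T : Finset (Fin N × Fin (d + 1)), #T = m ∧
        Separated π a Y (T : Set (Fin N × Fin (d + 1)))} : ℝ) < (N.factorial : ℝ) ^ (d + 1) / 2 := by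
  set wn := #(words (Fin d) a) with hwn
  set w₀ := #{l ∈ words (Fin d) a | l.length < a} with hw₀
  have hwpos : 0 < wn := by omega
  have hNpos : 0 < N := by omega
  have hN : (0 : ℝ) < N := by exact_mod_cast hNpos
  have hmR : (0 : ℝ) < m := lt_of_lt_of_le (by positivity) hm
  have hmpos : 0 < m := by exact_mod_cast hmR
  have hd1 : (1 : ℝ) ≤ (d : ℝ) ^ (t - 2) := one_le_pow₀ (by exact_mod_cast (by omega : 1 ≤ d))
  have hdR : (2 : ℝ) ≤ d := by exact_mod_cast hd
  have h2R : (wn : ℝ) * (2 * w₀ + 1) ≤ 10 * d ^ (t - 2) := by exact_mod_cast h2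
  have h3R : ((d : ℝ) - 2) ^ (t - 1) ≤ (wn : ℝ) ^ 2 + #Y * wn * (d - 2) := by
    have := (Nat.cast_le (α := ℝ)).2 h3
    push_cast [Nat.cast_sub hd] at this
    exact this
  have hwR : (1 : ℝ) ≤ wn := by exact_mod_cast hwpos
  have hNwR : (4 : ℝ) * wn ≤ N := by exact_mod_cast hNw
  have h1R : (2 : ℝ) * w₀ + 1 ≤ wn := by exact_mod_cast h1
  have hw₀R : (0 : ℝ) ≤ w₀ := Nat.cast_nonneg _
  set K := m * (2 * w₀ + 1) with hK
  have hKR : (K : ℝ) = m * (2 * w₀ + 1) := by rw [hK]; push_cast; ring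
  have hKhalf : (K : ℝ) ≤ N / 2 := by
    have e1 : μ * (2 * w₀ + 1) ≤ 1 / 8 := by
      have : (2 : ℝ) * w₀ + 1 ≤ wn * (2 * w₀ + 1) := le_mul_of_one_le_left (by positivity) hwR
      have : μ * (2 * w₀ + 1) ≤ μ * (10 * d ^ (t - 2)) :=
        mul_le_mul_of_nonneg_left (by linarith) hμ.le
      linarith
    have e2 : (K : ℝ) ≤ (μ * N + 1) * (2 * w₀ + 1) := by
      rw [hKR]; exact mul_le_mul_of_nonneg_right hm' (by positivity)
    have e3 : (μ * N + 1) * (2 * w₀ + 1) = (μ * (2 * w₀ + 1)) * N + (2 * w₀ + 1) := by ring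
    have e4 := mul_le_mul_of_nonneg_right e1 hN.le
    linarith
  have hKN : K < N := by
    have : (K : ℝ) < N := by linarith
    exact_mod_cast this
  have hcount := card_separated_mul_factorial_le (N := N) (m := m) Y hY hK hKN
    (Nat.mul_le_mul_left m h1)
  rw [← hwn] at hcount
  have hΔμ : (1 : ℝ) ≤ (d + 1) / μ := by
    rw [le_div_iff₀ hμ]
    have : 80 * μ ≤ 80 * μ * d ^ (t - 2) := le_mul_of_one_le_right (by positivity) hd1
    linarith
  have hexp : 1 + Real.log (((d : ℝ) + 1) * N / m) + 4 * K * wn / N - wn * (m * wn - 1) / N -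
      m * #Y * (((d : ℝ) - 2) * wn) / N ≤ -1 := by
    set ρ : ℝ := m / N with hρ
    have hρμ : μ ≤ ρ := by rw [hρ, le_div_iff₀ hN]; exact hm
    have e1 : Real.log (((d : ℝ) + 1) * N / m) ≤ Real.log ((d + 1) / μ) := by
      have : ((d : ℝ) + 1) * N / m = (d + 1) / ρ := by rw [hρ]; field_simp
      rw [this]
      refine Real.log_le_log (div_pos (by positivity) (hμ.trans_le hρμ)) ?_
      exact div_le_div_of_nonneg_left (by positivity) hμ hρμ
    have e2 : 4 * (K : ℝ) * wn / N - wn * (m * wn - 1) / N - m * #Y * (((d : ℝ) - 2) * wn) / N =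
        ρ * (4 * (wn * (2 * w₀ + 1)) - ((wn : ℝ) ^ 2 + #Y * wn * (d - 2))) + wn / N := by
      rw [hKR, hρ]; field_simp; ring
    set c : ℝ := 40 * d ^ (t - 2) - ((d : ℝ) - 2) ^ (t - 1) with hc
    have hlog := Real.log_nonneg hΔμ
    have hc0 : c ≤ 0 := by
      by_contra! h
      have := mul_pos hμ h
      rw [hc, mul_sub] at this
      linarith
    have e3 : ρ * (4 * (wn * (2 * w₀ + 1)) - ((wn : ℝ) ^ 2 + #Y * wn * (d - 2))) ≤ ρ * c :=
      mul_le_mul_of_nonneg_left (by linarith) (hμ.le.trans hρμ)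
    -- Since `c ≤ 0`, rounding `m` up can only help.
    have e4 : ρ * c ≤ μ * c := mul_le_mul_of_nonpos_right hρμ hc0
    have e5 : (wn : ℝ) / N ≤ 1 := by rw [div_le_one hN]; linarith
    have e6 : μ * c = μ * (40 * d ^ (t - 2)) - μ * ((d : ℝ) - 2) ^ (t - 1) := by rw [hc]; ring
    linarith
  have hD := descFactorial_le_pow_mul_exp N (m * wn) hNpos
  push_cast at hD
  have hbound := count_bound_le_exp (Δ := d + 1) (y := #Y) (e := (d : ℝ) - 2)
    rfl rfl hmpos hwpos hN (by positivity) (Nat.cast_nonneg K) hKhalf hexp hD (Nat.cast_nonneg _)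
  -- The correction term costs less than `2 * wn` per pair of a tree and a `Y`-vertex, turning `d`
  -- into `d - 2`.
  have hexple : Real.exp (-(((m * #Y * d : ℕ) * (m * wn : ℕ) -
      (m * #Y : ℕ) * (m * (2 * wn - 1) : ℕ)) / N : ℝ)) ≤
      Real.exp (-(m * #Y * (m * (((d : ℝ) - 2) * wn)) / N)) := by
    refine Real.exp_le_exp.2 (neg_le_neg (div_le_div_of_nonneg_right ?_ hN.le))
    push_cast [Nat.cast_sub (show 1 ≤ 2 * wn by omega)]
    have : (0 : ℝ) ≤ m * #Y * m := by positivity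
    linarith
  have hfac : (0 : ℝ) < m.factorial := by positivity
  have hNK : (0 : ℝ) < (N : ℝ) - K := by linarith
  have hfin : (#{π : Fin (d + 1) → Equiv.Perm (Fin N) | ∃ T : Finset (Fin N × Fin (d + 1)), #T = m ∧
        Separated π a Y (T : Set (Fin N × Fin (d + 1)))} : ℝ) * m.factorial ≤
      ((N.factorial : ℝ) ^ (d + 1) * Real.exp (-m)) * m.factorial := by
    refine hcount.trans ?_
    calc _ ≤ (N.factorial : ℝ) ^ (d + 1) * (((d : ℝ) + 1) ^ m * (N.descFactorial (m * wn) : ℝ) ^ 2 *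
          (((N : ℝ) - K)⁻¹ ^ (m * (2 * wn - 1)) *
            Real.exp (-(m * #Y * (m * (((d : ℝ) - 2) * wn)) / N)))) := by
          rw [mul_left_comm ((N.factorial : ℝ) ^ (d + 1)), mul_assoc ((N.factorial : ℝ) ^ (d + 1))]
          gcongr
      _ ≤ (N.factorial : ℝ) ^ (d + 1) * (m.factorial * Real.exp (-m)) :=
          mul_le_mul_of_nonneg_left hbound (by positivity)
      _ = _ := by ring
  have hfin' := le_of_mul_le_mul_right hfin hfac
  have hexp1 : Real.exp (-(m : ℝ)) < 1 / 2 := by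
    have h1m : (1 : ℝ) ≤ m := by exact_mod_cast hmpos
    have := Real.exp_le_exp.2 (neg_le_neg h1m)
    have := Real.exp_neg_one_lt_d9
    linarith
  have hNf : (0 : ℝ) < (N.factorial : ℝ) ^ (d + 1) := by positivity
  have := mul_lt_mul_of_pos_left hexp1 hNf
  linarith

/-- Fewer than `x` colour classes of about `μ * N` edges cannot cover the `d + 1` edges at each good
vertex: for large `N` the gap `d + 1 - x * μ > 0` outweighs the bounded number `R'` of lost vertices
and the rounding of `m`. -/
theorem exists_graph {d t : ℕ} (hd : 2 ≤ d) (ht : 2 ≤ t) {μ x : ℝ} (hμ : 0 < μ)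
    (hμ1 : 80 * μ * d ^ (t - 2) ≤ 1)
    (hmain : 3 + Real.log ((d + 1) / μ) + μ * (40 * d ^ (t - 2)) ≤ μ * ((d : ℝ) - 2) ^ (t - 1))
    (hx0 : 0 ≤ x) (hx : x * μ < d + 1) (g : ℕ) :
    ∃ (n : ℕ) (G : SimpleGraph (Fin n)) (_ : DecidableRel G.Adj),
      (g : ℕ∞) ≤ G.egirth ∧ G.maxDegree ≤ d + 1 ∧ x ≤ (G.distChromaticIndex t : ℝ) := by
  classical
  obtain ⟨a, Y, hY, hat, hYt, h1, h2, h3⟩ := exists_ball_parameters hd ht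
  set L := g + (2 * a + 3) with hL
  set R := 2 * (#(words (Fin (d + 1)) L) * 4 ^ L) with hR
  set R' := #(words (Fin (d + 1)) (a + 1)) * (#(words (Fin (d + 1)) L) * R) with hR'
  obtain ⟨N, hN⟩ := exists_nat_gt (max ((2 * L + 4 * #(words (Fin d) a) : ℕ) : ℝ)
    ((R' * (d + 1) + x) / (d + 1 - x * μ)))
  have hN1 : 2 * L + 4 * #(words (Fin d) a) < N := by exact_mod_cast (le_max_left _ _).trans_lt hN
  have hN2 := (le_max_right _ _).trans_lt hN
  rw [div_lt_iff₀ (by linarith)] at hN2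
  set m := ⌈μ * N⌉₊ with hm
  have hm1 : μ * N ≤ m := Nat.le_ceil _
  have hm2 : (m : ℝ) < μ * N + 1 := Nat.ceil_lt_add_one (by positivity)
  obtain ⟨π, hπ, hsep⟩ := exists_labelling (L := L) (a := a) (m := m) (Y := Y) (by omega) hR
    (card_separated_lt hd hY h1 h2 h3 hμ hμ1 hmain hm1 hm2.le (by omega))
  set e := Fintype.equivFin (Bool × Fin N)
  set H := (graph π L).map e.toEmbedding with hH
  set φ : graph π L ≃g H := SimpleGraph.Iso.map e (graph π L)
  refine ⟨_, H, inferInstance, ?_, ?_, ?_⟩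
  · rw [SimpleGraph.le_egirth]
    intro u p hp
    have := lt_length_of_isCycle π L _ (hp.map (f := φ.symm.toHom) φ.symm.injective)
    rw [SimpleGraph.Walk.length_map] at this
    exact_mod_cast (by omega)
  · refine SimpleGraph.maxDegree_le_of_forall_degree_le _ _ fun v => ?_
    rw [← φ.symm.degree_eq]
    exact (degree_graph_le π L _).trans_eq (Fintype.card_fin _)
  · by_contra! hlt
    refine hsep (exists_separated hat (by omega) hYt φ ?_)
    have hgood := card_good_add_le π L a
    have hB := card_shortClosed_le π L
    have hN3 : N ≤ #{i | Good π L a i} + R' := by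
      refine hgood.trans ?_
      rw [hR']
      gcongr
      exact hB.trans (by gcongr)
    have hN3R : (N : ℝ) ≤ #{i | Good π L a i} + R' := by exact_mod_cast hN3
    have hfin : ((H.distChromaticIndex t * m : ℕ) : ℝ) < ((#{i | Good π L a i} * (d + 1) : ℕ) : ℝ) := by
      push_cast
      have hm0 : (0 : ℝ) ≤ m := Nat.cast_nonneg _
      calc (H.distChromaticIndex t : ℝ) * m ≤ x * (μ * N + 1) := by gcongr
        _ < ((N : ℝ) - R') * (d + 1) := by nlinarith
        _ ≤ _ := by gcongr; linarith
    exact_mod_cast hfin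

end PermGraph

/-! ### Stars, the choice of μ, and the asymptotics -/

open Classical in
theorem SimpleGraph.le_distChromaticIndex_starGraph (Δ : ℕ) {t : ℕ} (ht : 1 ≤ t) :
    Δ ≤ (SimpleGraph.starGraph (0 : Fin (Δ + 1))).distChromaticIndex t := by
  set G := SimpleGraph.starGraph (0 : Fin (Δ + 1))
  obtain ⟨c, hc⟩ := G.exists_isDistEdgeColoring_distChromaticIndex t
  have hadj : ∀ i : Fin Δ, G.Adj 0 i.succ := fun i =>
    SimpleGraph.starGraph_center_adj (Fin.succ_ne_zero i).symm
  have hinj : Function.Injective fun i : Fin Δ => c ⟨s(0, i.succ), hadj i⟩ := by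
    intro i j hij
    by_contra hne
    refine hc ⟨s(0, i.succ), hadj i⟩ ⟨s(0, j.succ), hadj j⟩ ?_ ?_ hij
    · intro h
      have := congrArg Subtype.val h
      simp at this
      exact hne this
    · refine (SimpleGraph.edgeDist_le_length_add_one (Sym2.mem_mk_left _ _) (Sym2.mem_mk_left _ _)
        (SimpleGraph.Walk.nil (G := G))).trans ?_
      simpa using ht
  simpa using Fintype.card_le_of_injective _ hinj

namespace PermGraph

theorem exists_graph_of_log {t Δ : ℕ} (ht : 2 ≤ t) {ε : ℝ} (hε : 0 < ε) (hε1 : ε < 1) (hΔ : 3 ≤ Δ)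
    (h1 : 1 ≤ Real.log Δ) (h4 : 4 ≤ ε * Real.log Δ)
    (hsmall : (80 + 3 * t) * ((1 + ε) * (t * Real.log Δ)) ≤ Δ) (g : ℕ) :
    ∃ (n : ℕ) (G : SimpleGraph (Fin n)) (_ : DecidableRel G.Adj),
      (g : ℕ∞) ≤ G.egirth ∧ G.maxDegree ≤ Δ ∧
        (1 - ε) * ((Δ : ℝ) ^ t / (t * Real.log Δ)) ≤ (G.distChromaticIndex t : ℝ) := by
  obtain ⟨d, rfl⟩ : ∃ d, Δ = d + 1 := ⟨Δ - 1, by omega⟩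
  have hcast : ((d + 1 : ℕ) : ℝ) = (d : ℝ) + 1 := by push_cast; rfl
  rw [hcast] at h1 h4 hsmall ⊢
  set D : ℝ := (d : ℝ) + 1 with hD
  have hD3 : 3 ≤ D := by rw [← hcast]; exact_mod_cast hΔ
  have hD0 : 0 < D := by linarith
  set lam := Real.log D with hlam
  have htR : (2 : ℝ) ≤ t := by exact_mod_cast ht
  set T := (1 + ε) * (t * lam) with hT
  have htl : 2 ≤ t * lam := by nlinarith
  have hT1 : 1 ≤ T := by nlinarith
  obtain ⟨s, rfl⟩ : ∃ s, t = s + 2 := ⟨t - 2, by omega⟩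
  -- With this choice μΔ^(t-1) = (1+ε) t log Δ beats the entropy, while the desired index times μ is
  -- (1-ε²)Δ < Δ.
  set μ := T / D ^ (s + 1) with hμ
  have hμ0 : 0 < μ := by positivity
  have hTD : (80 + 3 * ((s + 2 : ℕ) : ℝ)) * (T / D) ≤ 1 := by
    rw [← mul_div_assoc, div_le_one hD0]; exact hsmall
  have hTD0 : 0 ≤ T / D := by positivity
  have hs0 : (0 : ℝ) ≤ s := Nat.cast_nonneg s
  push_cast at hTD
  have hμd : μ * (d : ℝ) ^ s ≤ T / D := by
    calc μ * (d : ℝ) ^ s ≤ μ * D ^ s := by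
          refine mul_le_mul_of_nonneg_left (pow_le_pow_left₀ (Nat.cast_nonneg _) ?_ _) hμ0.le
          rw [hD]; linarith
      _ = T / D := by rw [hμ, pow_succ]; field_simp
  refine exists_graph (d := d) (μ := μ) (by omega) ht hμ0 ?_ ?_ ?_ ?_ g
  · rw [show s + 2 - 2 = s by omega]
    nlinarith
  · rw [show s + 2 - 2 = s by omega, show s + 2 - 1 = s + 1 by omega, ← hD]
    have e1 : Real.log (D / μ) ≤ ((s + 2 : ℕ) : ℝ) * lam := by
      rw [hlam, ← Real.log_pow]
      refine Real.log_le_log (by positivity) ?_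
      rw [hμ, div_div_eq_mul_div, div_le_iff₀ (by positivity)]
      calc D * D ^ (s + 1) = D ^ (s + 2) := by ring
        _ ≤ D ^ (s + 2) * T := le_mul_of_one_le_right (by positivity) hT1
    -- Bernoulli's inequality with d - 2 = Δ - 3.
    have e2 : T - 3 * (s + 1) * (T / D) ≤ μ * ((d : ℝ) - 2) ^ (s + 1) := by
      have h := one_add_mul_le_pow (a := -(3 / D)) (by
        have : 3 / D ≤ 1 := by rw [div_le_one hD0]; exact hD3
        linarith) (s + 1)
      have h2 : (d : ℝ) - 2 = D * (1 + -(3 / D)) := by field_simp; rw [hD]; ring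
      rw [h2, mul_pow, hμ]
      have h3 : T / D ^ (s + 1) * (D ^ (s + 1) * (1 + -(3 / D)) ^ (s + 1)) =
        T * (1 + -(3 / D)) ^ (s + 1) := by field_simp
      rw [h3]
      refine le_trans (le_of_eq ?_) (mul_le_mul_of_nonneg_left h (by linarith))
      push_cast
      field_simp
      ring
    have e3 : T = ((s + 2 : ℕ) : ℝ) * lam + ((s + 2 : ℕ) : ℝ) * (ε * lam) := by rw [hT]; ring
    -- The surplus of `T` over t log Δ covers the constant 3 and the errors of order T/Δ, which
    -- total at most 1.
    have e4 : 4 ≤ ((s + 2 : ℕ) : ℝ) * (ε * lam) := by nlinarith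
    nlinarith
  · have : 0 ≤ 1 - ε := by linarith
    positivity
  · have : (1 - ε) * (D ^ (s + 2) / (((s + 2 : ℕ) : ℝ) * lam)) * μ = (1 - ε) * (1 + ε) * D := by
      rw [hμ, hT]
      have : ((s + 2 : ℕ) : ℝ) * lam ≠ 0 := by positivity
      field_simp
      ring
    rw [this]
    nlinarith [mul_pos hε hε]

theorem eventually_exists_graph {t : ℕ} (ht : 1 ≤ t) {ε : ℝ} (hε : 0 < ε) (hε1 : ε < 1) :
    ∀ᶠ Δ : ℕ in atTop, ∀ g : ℕ, ∃ (n : ℕ) (G : SimpleGraph (Fin n)) (_ : DecidableRel G.Adj),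
      (g : ℕ∞) ≤ G.egirth ∧ G.maxDegree ≤ Δ ∧
        (1 - ε) * ((Δ : ℝ) ^ t / (t * Real.log Δ)) ≤ (G.distChromaticIndex t : ℝ) := by
  have hlog : Tendsto (fun Δ : ℕ => Real.log Δ) atTop atTop :=
    Real.tendsto_log_atTop.comp tendsto_natCast_atTop_atTop
  have htR : (1 : ℝ) ≤ t := by exact_mod_cast ht
  set q : ℝ := (80 + 3 * t) * ((1 + ε) * t) with hq
  have hq0 : 0 < q := by positivity
  have hsmall : ∀ᶠ Δ : ℕ in atTop, q * Real.log Δ ≤ Δ := by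
    have := tendsto_natCast_atTop_atTop.eventually
      (isLittleO_iff.1 Real.isLittleO_log_id_atTop (inv_pos.2 hq0))
    filter_upwards [this] with Δ hΔ
    rw [id, Real.norm_eq_abs, Real.norm_eq_abs, Nat.abs_cast] at hΔ
    have := (le_abs_self _).trans hΔ
    rwa [inv_mul_eq_div, le_div_iff₀ hq0, mul_comm] at this
  filter_upwards [hlog.eventually_ge_atTop 1, hlog.eventually_ge_atTop (4 / ε), hsmall,
    eventually_ge_atTop 3] with Δ h1 h4 h5 h3 g
  rcases Nat.lt_or_ge 1 t with h | h
  · refine exists_graph_of_log h hε hε1 h3 h1 ?_ ?_ g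
    · rwa [div_le_iff₀' hε] at h4
    · refine le_trans (le_of_eq ?_) h5
      rw [hq]; ring
  -- A star has index at least Δ, more than Δ / log Δ requires, and no cycles.
  · obtain rfl : t = 1 := by omega
    classical
    refine ⟨Δ + 1, SimpleGraph.starGraph 0, inferInstance, ?_, ?_, ?_⟩
    · rw [(SimpleGraph.isAcyclic_starGraph _).egirth_eq_top]
      exact le_top
    · have := (SimpleGraph.starGraph (0 : Fin (Δ + 1))).maxDegree_lt_card_verts
      rw [Fintype.card_fin] at this
      omega
    · have hχ : (Δ : ℝ) ≤ ((SimpleGraph.starGraph (0 : Fin (Δ + 1))).distChromaticIndex 1 : ℝ) := by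
        exact_mod_cast SimpleGraph.le_distChromaticIndex_starGraph Δ le_rfl
      refine le_trans ?_ hχ
      rw [pow_one, Nat.cast_one, one_mul]
      have hΔ0 : (0 : ℝ) ≤ Δ := Nat.cast_nonneg Δ
      have : (Δ : ℝ) / Real.log Δ ≤ Δ := div_le_self hΔ0 h1
      have : 0 ≤ (Δ : ℝ) / Real.log Δ := by positivity
      nlinarith

end PermGraph

theorem proposition3 :
    ∃ f : ℕ → ℕ → ℝ,
      (∀ t : ℕ, 1 ≤ t →
        (fun Δ : ℕ => f Δ t) ~[atTop] fun Δ : ℕ => (Δ : ℝ) ^ t / ((t : ℝ) * Real.log (Δ : ℝ))) ∧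
      ∀ t : ℕ, 1 ≤ t → ∀ g : ℕ, 3 ≤ g → ∀ Δ : ℕ,
        ∃ (n : ℕ) (G : SimpleGraph (Fin n)) (_ : DecidableRel G.Adj),
          (g : ℕ∞) ≤ G.egirth ∧ G.maxDegree ≤ Δ ∧ f Δ t ≤ (G.distChromaticIndex t : ℝ) := by
  classical
  set T : ℕ → ℕ → ℝ := fun Δ t => (Δ : ℝ) ^ t / ((t : ℝ) * Real.log (Δ : ℝ)) with hT
  -- Quantifying over `g` here makes the resulting `f` independent of the girth; the empty graph
  -- gives `P Δ t 0` for every Δ.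
  set P : ℕ → ℕ → ℕ → Prop := fun Δ t k => ∀ g : ℕ,
    ∃ (n : ℕ) (G : SimpleGraph (Fin n)) (_ : DecidableRel G.Adj),
      (g : ℕ∞) ≤ G.egirth ∧ G.maxDegree ≤ Δ ∧ k ≤ G.distChromaticIndex t with hP
  have hP0 : ∀ Δ t, P Δ t 0 := fun Δ t g => by
    refine ⟨0, ⊥, inferInstance, ?_, ?_, Nat.zero_le _⟩
    · rw [SimpleGraph.isAcyclic_bot.egirth_eq_top]
      exact le_top
    · exact SimpleGraph.maxDegree_le_of_forall_degree_le _ _ fun v => v.elim0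
  set F : ℕ → ℕ → ℕ := fun Δ t => Nat.findGreatest (P Δ t) ⌈T Δ t⌉₊ with hF
  -- The minimum with `T` gives the upper half of the asymptotics; the lower half is that `F` is
  -- eventually at least (1-ε)`T`.
  refine ⟨fun Δ t => min (T Δ t) (F Δ t), fun t ht => ?_, fun t _ g _ Δ => ?_⟩
  · refine isLittleO_iff.2 fun c hc => ?_
    set ε := min c (1 / 2) with hε
    have hε0 : 0 < ε := lt_min hc (by norm_num)
    have hε1 : ε < 1 := (min_le_right _ _).trans_lt (by norm_num)
    filter_upwards [PermGraph.eventually_exists_graph ht hε0 hε1] with Δ hΔ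
    have hT0 : 0 ≤ T Δ t := by
      have := Real.log_natCast_nonneg Δ
      positivity
    have hle : (1 - ε) * T Δ t ≤ T Δ t := by nlinarith
    have hPk : P Δ t ⌈(1 - ε) * T Δ t⌉₊ := fun g => by
      obtain ⟨n, G, hdec, h1, h2, h3⟩ := hΔ g
      exact ⟨n, G, hdec, h1, h2, Nat.ceil_le.2 h3⟩
    have hFk : ⌈(1 - ε) * T Δ t⌉₊ ≤ F Δ t := Nat.le_findGreatest (Nat.ceil_mono hle) hPk
    have hmin : (1 - ε) * T Δ t ≤ min (T Δ t) (F Δ t) :=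
      le_min hle ((Nat.le_ceil _).trans (by exact_mod_cast hFk))
    have hmin' : min (T Δ t) (F Δ t : ℝ) ≤ T Δ t := min_le_left _ _
    change ‖min (T Δ t) (F Δ t : ℝ) - T Δ t‖ ≤ c * ‖T Δ t‖
    rw [Real.norm_eq_abs, Real.norm_eq_abs, abs_of_nonneg hT0, abs_of_nonpos (by linarith)]
    have := mul_le_mul_of_nonneg_right (min_le_left c (1 / 2)) hT0
    rw [← hε] at this
    linarith
  · obtain ⟨n, G, hdec, h1, h2, h3⟩ := Nat.findGreatest_spec (P := P Δ t)
      (Nat.zero_le ⌈T Δ t⌉₊) (hP0 Δ t) g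
    exact ⟨n, G, hdec, h1, h2, (min_le_right _ _).trans (by exact_mod_cast h3)⟩
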